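/- Fix $\delta\in(0,1]$ and let $N$ be a standard normal random variable. For an integrable real random variable $G$ put $d_1(G,N):=\sup_h|E[h(G)]-E[h(N)]|$, the supremum being over all differentiable $h:\mathbb R\to\mathbb R$ with $\|h'\|_\infty\le1$. For a real symmetric matrix $A=(a_{uv})_{u,v=1}^n$ with zero diagonal and independent real random variables $X_1,\dots,X_n$ with mean zero, variance one and $E|X_k|^{2+\delta}<\infty$, put $$F_n=\sum_{1\le u\le v\le n}a_{uv}X_uX_v,\qquad \sigma_n^2=\mathrm{Var}(F_n),\qquad \tilde L_n=\sigma_n^{-2}\max_{1\le u\le n}\sum_{v=1}^na_{uv}^2,$$ $$R_n=\sum_{u=1}^n\Big(\sum_{v=1}^na_{uv}^2\Big)^{\frac{2+\delta}2},\qquad T_n=\sum_{u,v=1}^n\Big|\sum_{k=1}^na_{ku}a_{kv}\Big|^{\frac{2+\delta}2}+\sum_{u,v=1}^n\sum_{k=1}^n|a_{ku}a_{kv}|^{\frac{2+\delta}2}.$$ (1) There is a constant $C_\delta>0$ depending only on $\delta$ such that, for all such $n$, $A$, $X_1,\dots,X_n$ with $\sigma_n>0$, $$d_1(F_n/\sigma_n,N)\le\frac{C_\delta}{\sigma_n^{2+\delta}}\Big(\max_{1\le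 w\le n}E|X_w|^{2+\delta}\Big)^2\Big\{R_n^{\frac{\delta}{2+\delta}}\,T_n^{\frac{2}{2+\delta}}+R_n\Big\}.$$ (2) Let $X_1,X_2,\dots$ be independent real random variables on one probability space with mean zero, variance one and $\sup_{k\ge1}E|X_k|^{2+\delta}<\infty$, and for each $n$ let $A=A^{(n)}$ be a real symmetric $n\times n$ matrix with zero diagonal, such that $\sigma_n>0$ for all sufficiently large $n$. If $\lim_{n\to\infty}\tilde L_n=0$ and, for some $\varepsilon\in(0,\delta]$, $$\sup_{n:\,\sigma_n>0}\ \frac{\tilde L_n^{\delta(\delta-\varepsilon)/4}}{\sigma_n^{2+\delta}}\,T_n<\infty,$$ then $F_n/\sigma_n$ converges in distribution to $N$ as $n\to\infty$. -/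

import Mathlib

open MeasureTheory ProbabilityTheory Filter Topology
open scoped ENNReal

noncomputable section

namespace QuadForm

variable {Ω : Type*} [MeasurableSpace Ω]

/-- The Wasserstein distance `d₁(G, N)` between an integrable random variable `G` and a standard
normal random variable `N`: the supremum of `|E[h(G)] - E[h(N)]|` over all differentiable
`h : ℝ → ℝ` with `|h'| ≤ 1` everywhere. It takes values in `[0, ∞]`, so that an unbounded
supremum is `∞`. -/
def d1 (P : Measure Ω) (G : Ω → ℝ) : ℝ≥0∞ :=
  ⨆ (h : ℝ → ℝ) (_ : Differentiable ℝ h ∧ ∀ x, |deriv h x| ≤ 1),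
    ENNReal.ofReal |(∫ ω, h (G ω) ∂P) - ∫ x, h x ∂(gaussianReal 0 1)|

/-- The quadratic form `F = ∑_{u ≤ v} a_{uv} X_u X_v`. -/
def form {n : ℕ} (A : Matrix (Fin n) (Fin n) ℝ) (X : Fin n → Ω → ℝ) (ω : Ω) : ℝ :=
  ∑ u : Fin n, ∑ v ∈ Finset.Ici u, A u v * X u ω * X v ω

/-- The standard deviation `σ` of the quadratic form, `σ² = Var(F)`. -/
def sigma (P : Measure Ω) {n : ℕ} (A : Matrix (Fin n) (Fin n) ℝ) (X : Fin n → Ω → ℝ) : ℝ :=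
  √(Var[form A X; P])

/-- `max_w E|X_w|^p`. -/
def maxMoment (P : Measure Ω) (p : ℝ) {n : ℕ} (X : Fin n → Ω → ℝ) : ℝ :=
  ⨆ w : Fin n, ∫ ω, |X w ω| ^ p ∂P

/-- `∑_u (∑_v a_{uv}²)^{(2+δ)/2}`. -/
def rowSum (δ : ℝ) {n : ℕ} (A : Matrix (Fin n) (Fin n) ℝ) : ℝ :=
  ∑ u, (∑ v, A u v ^ 2) ^ ((2 + δ) / 2)

/-- `∑_{u,v} |∑_k a_{ku} a_{kv}|^{(2+δ)/2} + ∑_{u,v} ∑_k |a_{ku} a_{kv}|^{(2+δ)/2}`. -/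
def crossSum (δ : ℝ) {n : ℕ} (A : Matrix (Fin n) (Fin n) ℝ) : ℝ :=
  (∑ u, ∑ v, |∑ k, A k u * A k v| ^ ((2 + δ) / 2)) +
    ∑ u, ∑ v, ∑ k, |A k u * A k v| ^ ((2 + δ) / 2)

/-- `L̃ = σ⁻² max_u ∑_v a_{uv}²`, meaningful when `σ > 0`. -/
def Ltilde (P : Measure Ω) {n : ℕ} (A : Matrix (Fin n) (Fin n) ℝ) (X : Fin n → Ω → ℝ) : ℝ :=
  (⨆ u : Fin n, ∑ v, A u v ^ 2) / sigma P A X ^ 2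

end QuadForm

end

/-! The proof is Stein's method. For a test function `k`, let `f` solve `f'(x) - x f(x) = k(x) - E
k(N)`; `f` and `f'` are bounded, and `f'` is Lipschitz, hence δ-Hölder
(`exists_stein_solution_holder`). After scaling to unit variance it remains to bound `E[f'(F) - F
f(F)]`.

Write `S_u = ∑_v a_{uv} X_v`. Symmetry and the zero diagonal give `F = ½ ∑_u X_u S_u`, and `F = w_u
+ X_u S_u` with `X_u` independent of `(S_u, w_u)`. Expanding `f` around `w_u`, the variables `X_u`
and `X_u² - 1` average out, so `E[X_u S_u f(F)]` is `E[S_u² f'(F)]` up to a multiple of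
`E|S_u|^{2+δ}` (`abs_integral_mul_sub_le`). These errors sum to `R`.

What is left is `-½ E[(∑_u S_u² - 2) f'(F)]`. The bracket equals `∑_v (r_v (X_v² - 1) + X_v Y_v)`,
where `r_v` is the squared norm of row `v` and `Y_v` is the linear form given by the off-diagonal
part of row `v` of the Gram matrix (`sum_row_sq_sub`). Each summand is centred given the other
coordinates, so `f'(F)` may be replaced by `f'(F) - f'(w_v)`, at the cost of a factor `|X_v S_v|^δ`
(`abs_integral_mul_centred_le`). This needs only `E[|S_v|^δ |Y_v|]`, which Young's inequality with a
free weight splits into `E|S_v|^{2+δ}` and `E|Y_v|^{(2+δ)/2}`. A Marcinkiewicz–Zygmund bound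
controls the first by `R`, a von Bahr–Esseen bound controls the second by `T`, and the optimal
weight yields `R^{δ/(2+δ)} T^{2/(2+δ)}`. The constant obtained, 1000, does not even depend on `δ`.

For the limit theorem, `R/σ^{2+δ} ≤ 2 L̃^{δ/2}` and the growth condition on `T` leave a positive
power of `L̃`. Sine and cosine are then used as test functions, and convergence of characteristic
functions concludes. -/

namespace QuadForm

/-! ### Stein's equation for the standard normal law and the smoothness of its solution. -/

lemma hasDerivAt_gaussianPDFReal (x : ℝ) :
    HasDerivAt (gaussianPDFReal 0 1) (-x * gaussianPDFReal 0 1 x) x := by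
  have h1 : HasDerivAt (fun y : ℝ => -(y - 0) ^ 2 / (2 * ((1 : NNReal) : ℝ))) (-x) x := by
    have h : HasDerivAt (fun y : ℝ => y - 0) 1 x := (hasDerivAt_id' x).sub_const 0
    exact ((h.fun_pow 2).fun_neg.div_const _).congr_deriv (by simp; ring)
  exact ((h1.exp).const_mul (√(2 * Real.pi * ((1 : NNReal) : ℝ)))⁻¹).congr_deriv
    (by simp only [gaussianPDFReal]; ring)

lemma tendsto_abs_mul_gaussianPDFReal_cocompact (s : ℝ) :
    Tendsto (fun x => |x| ^ s * gaussianPDFReal 0 1 x) (cocompact ℝ) (𝓝 0) := by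
  have := (tendsto_rpow_abs_mul_exp_neg_mul_sq_cocompact (a := 1 / 2) (by norm_num) s).const_mul
    (√(2 * Real.pi * ((1 : NNReal) : ℝ)))⁻¹
  rw [mul_zero] at this
  refine this.congr fun x => ?_
  simp only [gaussianPDFReal, sub_zero, NNReal.coe_one, mul_one]
  rw [show -(1 / 2) * x ^ 2 = -x ^ 2 / 2 by ring]; ring

lemma tendsto_affine_mul_gaussianPDFReal (α β : ℝ) :
    Tendsto (fun x => (α * |x| + β) * gaussianPDFReal 0 1 x) (cocompact ℝ) (𝓝 0) := by
  have h1 := (tendsto_abs_mul_gaussianPDFReal_cocompact 1).const_mul α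
  have h0 := (tendsto_abs_mul_gaussianPDFReal_cocompact 0).const_mul β
  have := h1.add h0
  simp only [mul_zero, add_zero, Real.rpow_one, Real.rpow_zero] at this
  exact this.congr fun x => by ring

/-- A function vanishing at infinity is bounded by any comparison function that vanishes at
infinity and decreases at least as fast as the function varies. -/
lemma abs_le_of_abs_deriv_le {p p' c c' : ℝ → ℝ} (hp : ∀ x, 0 ≤ x → HasDerivAt p (p' x) x)
    (hc : ∀ x, 0 ≤ x → HasDerivAt c (c' x) x) (hpc : ∀ x, 0 ≤ x → |p' x| ≤ -c' x)
    (hp0 : Tendsto p atTop (𝓝 0)) (hc0 : Tendsto c atTop (𝓝 0)) {x : ℝ} (hx : 0 ≤ x) :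
    |p x| ≤ c x := by
  -- Applied to `c + p` and `c - p`: both decrease to `0` on the half-line, hence are nonnegative.
  have key : ∀ g g' : ℝ → ℝ, (∀ x, 0 ≤ x → HasDerivAt g (g' x) x) → (∀ x, 0 ≤ x → g' x ≤ 0) →
      Tendsto g atTop (𝓝 0) → 0 ≤ g x := by
    intro g g' hg hg' h0
    have hanti : AntitoneOn g (Set.Ici 0) := by
      refine antitoneOn_of_deriv_nonpos (convex_Ici 0)
        (fun y hy => (hg y hy).continuousAt.continuousWithinAt) ?_ ?_
      · intro y hy
        rw [interior_Ici] at hy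
        exact (hg y (le_of_lt hy)).differentiableAt.differentiableWithinAt
      · intro y hy
        rw [interior_Ici] at hy
        rw [(hg y (le_of_lt hy)).deriv]
        exact hg' y (le_of_lt hy)
    refine le_of_tendsto h0 ?_
    filter_upwards [eventually_ge_atTop x] with y hy
    exact hanti hx (hx.trans hy) hy
  rw [abs_le]
  constructor
  · have := key (fun y => c y + p y) (fun y => c' y + p' y) (fun y hy => (hc y hy).add (hp y hy))
      (fun y hy => by have := hpc y hy; have := le_abs_self (p' y); linarith)
      (by simpa using hc0.add hp0)
    linarith
  · have := key (fun y => c y - p y) (fun y => c' y - p' y) (fun y hy => (hc y hy).sub (hp y hy))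
      (fun y hy => by have := hpc y hy; have := neg_abs_le (p' y); linarith)
      (by simpa using hc0.sub hp0)
    linarith

/-- Multiplying by the Gaussian density `φ` turns the equation into `(f φ)' = g φ`, and `(α +
2β/(1+x)) φ` is a comparison function decreasing fast enough. The decay `1/(1+x)` when `α = 0` is
what later bounds `x f'(x)`. -/
lemma stein_bound_of_nonneg {f g : ℝ → ℝ} {α β : ℝ} (hβ : 0 ≤ β)
    (hf : ∀ x, HasDerivAt f (x * f x + g x) x) (hg : ∀ x, |g x| ≤ α * |x| + β)
    (h0 : Tendsto (fun x => f x * gaussianPDFReal 0 1 x) atTop (𝓝 0)) {x : ℝ} (hx : 0 ≤ x) :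
    |f x| ≤ α + 2 * β / (1 + x) := by
  have hpos : ∀ x, 0 < gaussianPDFReal 0 1 x := fun x => gaussianPDFReal_pos _ _ _ one_ne_zero
  have hc0 : Tendsto (fun x => (α + 2 * β / (1 + x)) * gaussianPDFReal 0 1 x) atTop (𝓝 0) := by
    have h1 : Tendsto (gaussianPDFReal 0 1) atTop (𝓝 0) := by
      simpa using (tendsto_affine_mul_gaussianPDFReal 0 1).mono_left atTop_le_cocompact
    have h2 : Tendsto (fun x : ℝ => α + 2 * β / (1 + x)) atTop (𝓝 (α + 0)) :=
      tendsto_const_nhds.add (tendsto_const_nhds.div_atTop (tendsto_atTop_add_const_left _ _ tendsto_id))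
    simpa using h2.mul h1
  have := abs_le_of_abs_deriv_le (p := fun x => f x * gaussianPDFReal 0 1 x)
    (p' := fun x => g x * gaussianPDFReal 0 1 x)
    (c := fun x => (α + 2 * β / (1 + x)) * gaussianPDFReal 0 1 x)
    (c' := fun x => -((α * x + β * (2 * x / (1 + x) + 2 / (1 + x) ^ 2)) * gaussianPDFReal 0 1 x))
    (fun y _ => by
      exact ((hf y).fun_mul (hasDerivAt_gaussianPDFReal y)).congr_deriv (by ring))
    (fun y hy => by
      have hy' : (1 + y) ≠ 0 := by positivity
      have h1 : HasDerivAt (fun x : ℝ => 1 + x) 1 y := (hasDerivAt_id y).const_add 1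
      have h2 : HasDerivAt (fun x : ℝ => α + 2 * β / (1 + x))
          ((0 * (1 + y) - 2 * β * 1) / (1 + y) ^ 2) y :=
        ((hasDerivAt_const y (2 * β)).fun_div h1 hy').const_add α
      refine (h2.fun_mul (hasDerivAt_gaussianPDFReal y)).congr_deriv ?_
      field_simp; ring)
    (fun y hy => by
      rw [abs_mul, abs_of_pos (hpos y), neg_neg]
      refine mul_le_mul_of_nonneg_right ((hg y).trans ?_) (hpos y).le
      rw [abs_of_nonneg hy]
      have hy' : (0 : ℝ) < 1 + y := by positivity
      have : 1 ≤ 2 * y / (1 + y) + 2 / (1 + y) ^ 2 := by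
        rw [div_add_div _ _ hy'.ne' (by positivity), le_div_iff₀ (by positivity)]
        nlinarith [mul_nonneg hy hy, mul_nonneg hy (mul_nonneg hy hy)]
      nlinarith)
    h0 hc0 hx
  simp only [abs_mul, abs_of_pos (hpos x)] at this
  exact le_of_mul_le_mul_right this (hpos x)

lemma stein_bound {f g : ℝ → ℝ} {α β : ℝ} (hβ : 0 ≤ β)
    (hf : ∀ x, HasDerivAt f (x * f x + g x) x) (hg : ∀ x, |g x| ≤ α * |x| + β)
    (h0 : Tendsto (fun x => f x * gaussianPDFReal 0 1 x) (cocompact ℝ) (𝓝 0)) (x : ℝ) :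
    |f x| ≤ α + 2 * β / (1 + |x|) := by
  rcases le_total 0 x with hx | hx
  · rw [abs_of_nonneg hx]
    exact stein_bound_of_nonneg hβ hf hg (h0.mono_left atTop_le_cocompact) hx
  · have hsymm : ∀ y, gaussianPDFReal 0 1 (-y) = gaussianPDFReal 0 1 y := fun y => by
      simp [gaussianPDFReal]
    -- Reflection preserves the form of the equation, with `g` replaced by `y ↦ -g(-y)`.
    have := stein_bound_of_nonneg (f := fun y => f (-y)) (g := fun y => -g (-y)) hβ
      (fun y => by
        exact ((hf (-y)).scomp y (hasDerivAt_neg y)).congr_deriv (by simp only [smul_eq_mul]; ring))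
      (fun y => by simpa using hg (-y))
      (by
        have h1 := (h0.mono_left atBot_le_cocompact).comp tendsto_neg_atTop_atBot
        refine h1.congr fun y => ?_
        simp [hsymm])
      (neg_nonneg.2 hx)
    simpa [abs_of_nonpos hx] using this

lemma lipschitz_of_abs_deriv_le_one {h : ℝ → ℝ} (hd : Differentiable ℝ h)
    (hb : ∀ x, |deriv h x| ≤ 1) (x y : ℝ) : |h x - h y| ≤ |x - y| := by
  have := Convex.norm_image_sub_le_of_norm_deriv_le (f := h) (C := 1) (s := Set.univ) (x := y)
    (y := x) (fun z _ => hd z) (fun z _ => hb z) convex_univ trivial trivial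
  simpa using this

lemma integrable_of_lipschitz {Ω : Type*} [MeasurableSpace Ω] {P : Measure Ω}
    [IsProbabilityMeasure P] {h : ℝ → ℝ} (hc : Continuous h)
    (hl : ∀ x y, |h x - h y| ≤ |x - y|) {G : Ω → ℝ} (hG : Integrable G P) :
    Integrable (fun ω => h (G ω)) P := by
  refine Integrable.mono' (hG.norm.add (integrable_const |h 0|))
    (hc.comp_aestronglyMeasurable hG.1) (Eventually.of_forall fun ω => ?_)
  have h1 := hl (G ω) 0
  have h2 := abs_add_le (h (G ω) - h 0) (h 0)
  simp only [sub_zero, sub_add_cancel] at h1 h2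
  simp only [Real.norm_eq_abs, Pi.add_apply]
  linarith

lemma abs_sub_integral_gaussianReal_le {h : ℝ → ℝ} (hc : Continuous h)
    (hl : ∀ x y, |h x - h y| ≤ |x - y|) (x : ℝ) :
    |h x - ∫ y, h y ∂(gaussianReal 0 1)| ≤ |x| + 1 := by
  have hid2 : MemLp (fun y : ℝ => y) 2 (gaussianReal 0 1) := memLp_id_gaussianReal 2
  have hid : Integrable (fun y : ℝ => y) (gaussianReal 0 1) := hid2.integrable (by norm_num)
  have hi := integrable_of_lipschitz hc hl hid
  have hv : ∫ y, y ^ 2 ∂(gaussianReal 0 1) = 1 := by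
    have h1 := variance_fun_id_gaussianReal (μ := 0) (v := 1)
    rw [variance_of_integral_eq_zero (by fun_prop) (by simp)] at h1
    simpa using h1
  have h1 : ∫ y, |y| ∂(gaussianReal 0 1) ≤ 1 := by
    have : ∫ y, |y| ∂(gaussianReal 0 1) ≤ ∫ y, (1 / 2 + 1 / 2 * y ^ 2) ∂(gaussianReal 0 1) := by
      refine integral_mono hid.abs ((integrable_const _).add (hid2.integrable_sq.const_mul _)) ?_
      -- `|y| ≤ (1 + y²)/2`, so unit variance gives `E|N| ≤ 1`.
      intro y
      simp only
      nlinarith [sq_nonneg (|y| - 1), sq_abs y]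
    rw [integral_add (integrable_const _) (hid2.integrable_sq.const_mul _),
      integral_const_mul, hv] at this
    norm_num at this
    exact this
  have h2 : h x - ∫ y, h y ∂(gaussianReal 0 1) = ∫ y, (h x - h y) ∂(gaussianReal 0 1) := by
    rw [integral_sub (integrable_const _) hi]; simp
  rw [h2]
  calc |∫ y, (h x - h y) ∂(gaussianReal 0 1)| ≤ ∫ y, |h x - h y| ∂(gaussianReal 0 1) :=
        abs_integral_le_integral_abs
    _ ≤ ∫ y, (|x| + |y|) ∂(gaussianReal 0 1) :=
        integral_mono ((integrable_const _).sub hi).abs ((integrable_const _).add hid.abs)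
          fun y => (hl x y).trans (abs_sub _ _)
    _ = |x| + ∫ y, |y| ∂(gaussianReal 0 1) := by
        rw [integral_add (integrable_const _) hid.abs]; simp
    _ ≤ _ := by linarith

/-- Solution of Stein's equation for a continuous Lipschitz function. -/
lemma exists_stein_solution {h : ℝ → ℝ} (hc : Continuous h)
    (hl : ∀ x y, |h x - h y| ≤ |x - y|) :
    ∃ f : ℝ → ℝ, (∀ x, HasDerivAt f (x * f x + (h x - ∫ y, h y ∂(gaussianReal 0 1))) x) ∧
      Tendsto (fun x => f x * gaussianPDFReal 0 1 x) (cocompact ℝ) (𝓝 0) := by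
  set g : ℝ → ℝ := fun x => h x - ∫ y, h y ∂(gaussianReal 0 1) with hgdef
  set k : ℝ → ℝ := fun x => gaussianPDFReal 0 1 x * g x with hkdef
  have hpos : ∀ x, 0 < gaussianPDFReal 0 1 x := fun x => gaussianPDFReal_pos _ _ _ one_ne_zero
  have hρc : Continuous (gaussianPDFReal 0 1) :=
    continuous_iff_continuousAt.2 fun x => (hasDerivAt_gaussianPDFReal x).continuousAt
  have hkc : Continuous k := hρc.mul (hc.sub continuous_const)
  have hid : Integrable (fun y : ℝ => y) (gaussianReal 0 1) :=
    (memLp_id_gaussianReal 2).integrable (by norm_num)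
  have hhi := integrable_of_lipschitz hc hl hid
  have hgi : Integrable g (gaussianReal 0 1) := hhi.sub (integrable_const _)
  have hki : Integrable k := by
    rw [gaussianReal_of_var_ne_zero _ one_ne_zero, integrable_withDensity_iff
      (measurable_gaussianPDF _ _) (Eventually.of_forall fun x => gaussianPDF_lt_top)] at hgi
    refine hgi.congr (Eventually.of_forall fun x => ?_)
    simp [hkdef, toReal_gaussianPDF, mul_comm]
  have hk0 : ∫ x, k x = 0 := by
    have h1 : ∫ x, g x ∂(gaussianReal 0 1) = 0 := by
      rw [hgdef, integral_sub hhi (integrable_const _)]; simp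
    rw [integral_gaussianReal_eq_integral_smul one_ne_zero] at h1
    simpa [hkdef] using h1
  -- This is the integral of `k` over `(-∞, x]`, in a form to which the fundamental theorem of
  -- calculus applies. It vanishes at `-∞` by construction and at `+∞` because `k` has integral
  -- zero.
  set p : ℝ → ℝ := fun x => (∫ y in Set.Iic 0, k y) + ∫ y in (0 : ℝ)..x, k y with hpdef
  have hp : ∀ x, HasDerivAt p (k x) x := fun x =>
    (intervalIntegral.integral_hasDerivAt_right (hkc.intervalIntegrable _ _)
      (hkc.stronglyMeasurableAtFilter _ _) hkc.continuousAt).const_add _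
  refine ⟨fun x => p x / gaussianPDFReal 0 1 x, fun x => ?_, ?_⟩
  · refine ((hp x).fun_div (hasDerivAt_gaussianPDFReal x) (hpos x).ne').congr_deriv ?_
    have := (hpos x).ne'
    simp only [hkdef]
    field_simp
    ring
  · have : ∀ x, p x / gaussianPDFReal 0 1 x * gaussianPDFReal 0 1 x = p x := fun x =>
      div_mul_cancel₀ _ (hpos x).ne'
    simp only [this]
    rw [cocompact_eq_atBot_atTop, tendsto_sup]
    constructor
    · have h1 := intervalIntegral_tendsto_integral_Iic 0 hki.integrableOn tendsto_id
      have h2 := (tendsto_const_nhds (x := ∫ y in Set.Iic 0, k y)).sub h1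
      rw [sub_self] at h2
      refine h2.congr fun x => ?_
      simp only [hpdef, id]
      rw [intervalIntegral.integral_symm 0 x]; ring
    · have h1 := intervalIntegral_tendsto_integral_Ioi 0 hki.integrableOn tendsto_id
      have h2 := (tendsto_const_nhds (x := ∫ y in Set.Iic 0, k y)).add h1
      rw [intervalIntegral.integral_Iic_add_Ioi hki.integrableOn hki.integrableOn, hk0] at h2
      exact h2

/-- Solution of Stein's equation with its smoothness bounds. -/
lemma exists_stein_solution_bounds {h : ℝ → ℝ} (hd : Differentiable ℝ h)
    (hb : ∀ x, |deriv h x| ≤ 1) :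
    ∃ f f' : ℝ → ℝ, (∀ x, HasDerivAt f (f' x) x) ∧
      (∀ x, f' x - x * f x = h x - ∫ y, h y ∂(gaussianReal 0 1)) ∧
      (∀ x, |f x| ≤ 3) ∧ (∀ x, |f' x| ≤ 8) ∧ ∀ x y, |f' x - f' y| ≤ 12 * |x - y| := by
  have hl := lipschitz_of_abs_deriv_le_one hd hb
  obtain ⟨f, hf, hf0⟩ := exists_stein_solution hd.continuous hl
  set c := ∫ y, h y ∂(gaussianReal 0 1) with hcdef
  have hg := abs_sub_integral_gaussianReal_le hd.continuous hl
  have hfb : ∀ x, |f x| ≤ 3 := fun x => by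
    have h1 := stein_bound (α := 1) zero_le_one hf (fun x => by simpa using hg x) hf0 x
    have h2 : 2 * 1 / (1 + |x|) ≤ 2 := by
      rw [div_le_iff₀ (by positivity)]; nlinarith [abs_nonneg x]
    linarith
  -- The derivative `u = f'` solves Stein's equation again, with right-hand side `f + h'`, which is
  -- bounded by `3 + 1 = 4`. Hence `|u| ≤ 8/(1+|x|)` and `|u'| ≤ 8 + 4 = 12`.
  have hu : ∀ x, HasDerivAt (fun x => x * f x + (h x - c))
      (x * (x * f x + (h x - c)) + (f x + deriv h x)) x := fun x => by
    exact (((hasDerivAt_id' x).fun_mul (hf x)).fun_add ((hd x).hasDerivAt.sub_const c)).congr_deriv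
      (by ring)
  have hu0 : Tendsto (fun x => (x * f x + (h x - c)) * gaussianPDFReal 0 1 x)
      (cocompact ℝ) (𝓝 0) := by
    refine squeeze_zero_norm (fun x => ?_) (tendsto_affine_mul_gaussianPDFReal 4 1)
    have hpos : 0 < gaussianPDFReal 0 1 x := gaussianPDFReal_pos _ _ _ one_ne_zero
    rw [Real.norm_eq_abs, abs_mul, abs_of_pos hpos]
    refine mul_le_mul_of_nonneg_right ((abs_add_le _ _).trans ?_) hpos.le
    rw [abs_mul]
    nlinarith [hfb x, abs_nonneg x, hg x]
  have hk : ∀ x, |f x + deriv h x| ≤ 4 := fun x =>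
    (abs_add_le _ _).trans (by linarith [hfb x, hb x])
  have hub : ∀ x, |x * f x + (h x - c)| ≤ 8 / (1 + |x|) := fun x => by
    have := stein_bound (α := 0) (by norm_num : (0 : ℝ) ≤ 4) hu (fun x => by simpa using hk x) hu0 x
    convert this using 1
    norm_num
  refine ⟨f, fun x => x * f x + (h x - c), hf, fun x => by ring, hfb, fun x => ?_, fun x y => ?_⟩
  · refine (hub x).trans ?_
    rw [div_le_iff₀ (by positivity)]; nlinarith [abs_nonneg x]
  · have := Convex.norm_image_sub_le_of_norm_hasDerivWithin_le
      (f := fun x => x * f x + (h x - c)) (C := 12)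
      (s := Set.univ) (x := y) (y := x) (fun z _ => (hu z).hasDerivWithinAt) (fun z _ => ?_)
      convex_univ trivial trivial
    · simpa using this
    · rw [Real.norm_eq_abs]
      refine (abs_add_le _ _).trans ?_
      rw [abs_mul]
      have h1 : |z| * |z * f z + (h z - c)| ≤ 8 := by
        refine (mul_le_mul_of_nonneg_left (hub z) (abs_nonneg z)).trans ?_
        rw [mul_div_assoc', div_le_iff₀ (by positivity)]
        nlinarith [abs_nonneg z]
      linarith [hk z]

/-- The derivative of the solution of Stein's equation is Hölder continuous of any order in
`(0, 1]`. -/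
lemma exists_stein_solution_holder {δ : ℝ} (hδ0 : 0 < δ) (hδ1 : δ ≤ 1) {h : ℝ → ℝ}
    (hd : Differentiable ℝ h) (hb : ∀ x, |deriv h x| ≤ 1) :
    ∃ f f' : ℝ → ℝ, (∀ x, HasDerivAt f (f' x) x) ∧
      (∀ x, f' x - x * f x = h x - ∫ y, h y ∂(gaussianReal 0 1)) ∧
      (∀ x, |f x| ≤ 3) ∧ (∀ x, |f' x| ≤ 8) ∧ Continuous f' ∧
      ∀ x y, |f' x - f' y| ≤ 16 * |x - y| ^ δ := by
  obtain ⟨f, f', h1, h2, h3, h4, h5⟩ := exists_stein_solution_bounds hd hb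
  refine ⟨f, f', h1, h2, h3, h4, ?_, fun x y => ?_⟩
  · have : LipschitzWith 12 f' := LipschitzWith.of_dist_le_mul fun x y => by
      simpa [Real.dist_eq] using h5 x y
    exact this.continuous
  -- At distance at most one the Lipschitz constant 12 suffices; beyond it the bound `|f'| ≤ 8`
  -- gives `16`.
  · rcases le_total |x - y| 1 with hxy | hxy
    · have : |x - y| ≤ |x - y| ^ δ := by
        simpa using Real.rpow_le_rpow_of_exponent_ge_of_imp (abs_nonneg (x - y)) hxy hδ1
          (fun _ h => absurd h one_ne_zero)
      nlinarith [h5 x y, abs_nonneg (x - y)]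
    · have h6 : 1 ≤ |x - y| ^ δ := Real.one_le_rpow hxy hδ0.le
      have := abs_sub (f' x) (f' y)
      linarith [h4 x, h4 y]

/-! ### Taylor inequalities for powers of the absolute value. -/

/-- First-order Taylor estimate from the modulus of continuity of the derivative. -/
lemma abs_taylor_le {f f' : ℝ → ℝ} (hf : ∀ x, HasDerivAt f (f' x) x) {x y B : ℝ}
    (hB : ∀ z, |z - x| ≤ |y| → |f' z - f' x| ≤ B) :
    |f (x + y) - f x - f' x * y| ≤ B * |y| := by
  have := Convex.norm_image_sub_le_of_norm_hasDerivWithin_le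
    (f := fun z => f z - f' x * z) (f' := fun z => f' z - f' x) (C := B)
    (s := Metric.closedBall x |y|) (x := x) (y := x + y)
    (fun z _ => (((hf z).fun_sub ((hasDerivAt_id' z).const_mul (f' x))).congr_deriv
      (by ring)).hasDerivWithinAt)
    (fun z hz => hB z (by simpa [Real.dist_eq] using hz)) (convex_closedBall _ _)
    (by simp) (by simp)
  simp only [Real.norm_eq_abs] at this
  rwa [add_sub_cancel_left, show f (x + y) - f' x * (x + y) - (f x - f' x * x) =
    f (x + y) - f x - f' x * y by ring] at this

lemma abs_rpow_sub_one_mul_self {α : ℝ} (hα : 0 < α) {x : ℝ} (hx : 0 ≤ x) :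
    |x| ^ (α - 1) * x = x ^ α := by
  rw [abs_of_nonneg hx]
  rcases hx.eq_or_lt with rfl | hx
  · rw [Real.zero_rpow hα.ne', mul_zero]
  · rw [Real.rpow_sub_one hx.ne']; field_simp

/-- For equal signs this is subadditivity of `x ↦ x^α`; for opposite signs both powers are at most
`|a - b|^α`, whence the factor 2. With `α = q - 1` it is the modulus of continuity of the derivative
of `|x|^q / q`. -/
lemma abs_signed_rpow_sub_le {α : ℝ} (hα0 : 0 < α) (hα1 : α ≤ 1) (a b : ℝ) :
    |(|a| ^ (α - 1) * a - |b| ^ (α - 1) * b)| ≤ 2 * |a - b| ^ α := by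
  have hneg : ∀ {x : ℝ}, x ≤ 0 → |x| ^ (α - 1) * x = -(-x) ^ α := fun {x} hx => by
    have := abs_rpow_sub_one_mul_self hα0 (neg_nonneg.2 hx)
    rw [abs_neg] at this; linarith
  have hmono : ∀ {x y : ℝ}, 0 ≤ y → y ≤ x → |x ^ α - y ^ α| ≤ 2 * |x - y| ^ α := by
    intro x y hy hxy
    have h1 := Real.rpow_add_le_add_rpow (sub_nonneg.2 hxy) hy hα0.le hα1
    rw [sub_add_cancel] at h1
    have h2 := Real.rpow_le_rpow hy hxy hα0.le
    have h3 := Real.rpow_nonneg (sub_nonneg.2 hxy) α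
    rw [abs_of_nonneg (sub_nonneg.2 h2), abs_of_nonneg (sub_nonneg.2 hxy)]
    linarith
  have hpos : ∀ {x y : ℝ}, 0 ≤ x → 0 ≤ y → |x ^ α - y ^ α| ≤ 2 * |x - y| ^ α := by
    intro x y hx hy
    rcases le_total y x with h | h
    · exact hmono hy h
    · rw [abs_sub_comm, abs_sub_comm x]; exact hmono hx h
  have hopp : ∀ {x y : ℝ}, 0 ≤ x → 0 ≤ y → x ^ α + y ^ α ≤ 2 * (x + y) ^ α := by
    intro x y hx hy
    have h1 := Real.rpow_le_rpow hx (le_add_of_nonneg_right hy) hα0.le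
    have h2 := Real.rpow_le_rpow hy (le_add_of_nonneg_left hx) hα0.le
    linarith
  rcases le_total 0 a with ha | ha <;> rcases le_total 0 b with hb | hb
  · rw [abs_rpow_sub_one_mul_self hα0 ha, abs_rpow_sub_one_mul_self hα0 hb]
    exact hpos ha hb
  · rw [abs_rpow_sub_one_mul_self hα0 ha, hneg hb, sub_neg_eq_add, abs_of_nonneg
      (add_nonneg (Real.rpow_nonneg ha _) (Real.rpow_nonneg (neg_nonneg.2 hb) _)),
      abs_of_nonneg (by linarith : 0 ≤ a - b), sub_eq_add_neg]
    exact hopp ha (neg_nonneg.2 hb)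
  · rw [hneg ha, abs_rpow_sub_one_mul_self hα0 hb, ← abs_neg, abs_of_nonneg
      (by linarith [Real.rpow_nonneg hb α, Real.rpow_nonneg (neg_nonneg.2 ha) α]),
      abs_sub_comm, abs_of_nonneg (by linarith : 0 ≤ b - a)]
    have := hopp hb (neg_nonneg.2 ha)
    rw [← sub_eq_add_neg] at this
    linarith
  · rw [hneg ha, hneg hb]
    have := hpos (neg_nonneg.2 ha) (neg_nonneg.2 hb)
    rwa [show -a - -b = -(a - b) by ring, abs_neg, ← abs_neg,
      show -((-a) ^ α - (-b) ^ α) = -(-a) ^ α - -(-b) ^ α by ring] at this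

/-- The term linear in `y` is kept exactly, because it has mean zero when `y` is a centred variable
independent of `x`. The constant is `4 ≥ 2q`. -/
lemma abs_add_rpow_le_of_le_two {q : ℝ} (hq1 : 1 < q) (hq2 : q ≤ 2) (x y : ℝ) :
    |x + y| ^ q ≤ |x| ^ q + q * |x| ^ (q - 2) * x * y + 4 * |y| ^ q := by
  have h := abs_taylor_le (f := fun x => |x| ^ q) (f' := fun x => q * |x| ^ (q - 2) * x)
    (fun x => hasDerivAt_abs_rpow x hq1) (x := x) (y := y) (B := 4 * |y| ^ (q - 1)) (by
      intro z hz
      have h1 := abs_signed_rpow_sub_le (by linarith : 0 < q - 1) (by linarith) z x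
      have h2 := Real.rpow_le_rpow (abs_nonneg _) hz (by linarith : 0 ≤ q - 1)
      rw [show q - 1 - 1 = q - 2 by ring] at h1
      rw [show q * |z| ^ (q - 2) * z - q * |x| ^ (q - 2) * x =
        q * (|z| ^ (q - 2) * z - |x| ^ (q - 2) * x) by ring, abs_mul, abs_of_pos (by linarith)]
      have h3 := Real.rpow_nonneg (abs_nonneg (z - x)) (q - 1)
      nlinarith)
  have h4 : 4 * |y| ^ (q - 1) * |y| = 4 * |y| ^ q := by
    rw [mul_assoc]
    congr 1
    have := abs_rpow_sub_one_mul_self (by linarith : 0 < q) (abs_nonneg y)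
    rwa [abs_abs] at this
  rw [h4] at h
  have := (abs_le.1 h).2
  linarith

lemma abs_rpow_mul_self_sub_le {δ : ℝ} (hδ0 : 0 < δ) (hδ1 : δ ≤ 1) {a b m : ℝ} (ha : |a| ≤ m)
    (hb : |b| ≤ m) : |(|a| ^ δ * a - |b| ^ δ * b)| ≤ 2 * m ^ δ * |a - b| := by
  wlog hab : |b| ≤ |a| generalizing a b
  · rw [abs_sub_comm, abs_sub_comm a]
    exact this hb ha (le_of_not_ge hab)
  -- Dividing by `|a|^(1+δ)` and setting `t = |b|/|a|`, the claim is `t (1 - t^δ) ≤ 1 - t`, which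
  -- follows from `t ≤ t^δ` and `t ≤ 1`.
  have h1 : |b| * (|a| ^ δ - |b| ^ δ) ≤ |a| ^ δ * (|a| - |b|) := by
    rcases (abs_nonneg a).eq_or_lt with h | h
    · have : |b| = 0 := le_antisymm (hab.trans h.ge) (abs_nonneg b)
      simp [← h, this]
    · set t := |b| / |a| with ht
      have ht0 : 0 ≤ t := by positivity
      have ht1 : t ≤ 1 := (div_le_one h).2 hab
      have hb' : |b| = t * |a| := by rw [ht]; field_simp
      have h2 : t ≤ t ^ δ := by
        simpa using Real.rpow_le_rpow_of_exponent_ge_of_imp ht0 ht1 hδ1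
          (fun _ h => absurd h one_ne_zero)
      rw [hb', Real.mul_rpow ht0 h.le]
      have h3 : t * (1 - t ^ δ) ≤ 1 - t := by nlinarith
      have h4 : 0 ≤ |a| * |a| ^ δ := by positivity
      nlinarith
  have h2 : |a| ^ δ ≤ m ^ δ := Real.rpow_le_rpow (abs_nonneg a) ha hδ0.le
  have h3 : 0 ≤ |a| ^ δ - |b| ^ δ :=
    sub_nonneg.2 (Real.rpow_le_rpow (abs_nonneg b) hab hδ0.le)
  have h4 : |a| - |b| ≤ |a - b| := abs_sub_abs_le_abs_sub a b
  calc |(|a| ^ δ * a - |b| ^ δ * b)| = |(|a| ^ δ * (a - b) + b * (|a| ^ δ - |b| ^ δ))| := by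
        congr 1; ring
    _ ≤ |a| ^ δ * |a - b| + |b| * (|a| ^ δ - |b| ^ δ) := by
        refine (abs_add_le _ _).trans ?_
        rw [abs_mul, abs_mul, abs_of_nonneg h3, abs_of_nonneg (Real.rpow_nonneg (abs_nonneg a) δ)]
    _ ≤ |a| ^ δ * |a - b| + |a| ^ δ * |a - b| := by
        have := Real.rpow_nonneg (abs_nonneg a) δ
        exact add_le_add_right (h1.trans (mul_le_mul_of_nonneg_left h4 this)) _
    _ ≤ _ := by nlinarith [abs_nonneg (a - b)]

lemma abs_add_rpow_le_of_le_three {δ : ℝ} (hδ0 : 0 < δ) (hδ1 : δ ≤ 1) (x y : ℝ) :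
    |x + y| ^ (2 + δ) ≤ |x| ^ (2 + δ) + (2 + δ) * |x| ^ δ * x * y +
      6 * (|x| ^ δ * y ^ 2 + |y| ^ (2 + δ)) := by
  have h := abs_taylor_le (f := fun x => |x| ^ (2 + δ)) (f' := fun x => (2 + δ) * |x| ^ δ * x)
    (fun x => by
      have := hasDerivAt_abs_rpow x (by linarith : 1 < 2 + δ)
      rwa [add_sub_cancel_left] at this)
    (x := x) (y := y) (B := 6 * (|x| ^ δ + |y| ^ δ) * |y|) (by
      intro z hz
      have hz' : |z| ≤ |x| + |y| := by
        have := abs_add_le x (z - x)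
        rw [add_sub_cancel] at this; linarith
      have h1 := abs_rpow_mul_self_sub_le hδ0 hδ1 hz'
        (le_add_of_nonneg_right (abs_nonneg y) : |x| ≤ |x| + |y|)
      have h2 := Real.rpow_add_le_add_rpow (abs_nonneg x) (abs_nonneg y) hδ0.le hδ1
      rw [show (2 + δ) * |z| ^ δ * z - (2 + δ) * |x| ^ δ * x =
        (2 + δ) * (|z| ^ δ * z - |x| ^ δ * x) by ring, abs_mul, abs_of_pos (by linarith)]
      calc (2 + δ) * |(|z| ^ δ * z - |x| ^ δ * x)|
          ≤ 3 * (2 * (|x| + |y|) ^ δ * |z - x|) := by gcongr; linarith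
        _ ≤ 3 * (2 * (|x| ^ δ + |y| ^ δ) * |y|) := by gcongr
        _ = _ := by ring)
  have h4 : |y| ^ (2 + δ) = |y| ^ δ * y ^ 2 := by
    rcases eq_or_ne y 0 with rfl | hy
    · simp [Real.zero_rpow (by linarith : 2 + δ ≠ 0)]
    · rw [add_comm, Real.rpow_add (abs_pos.2 hy), Real.rpow_two, sq_abs]
  have := (abs_le.1 h).2
  have h5 : |y| * |y| = y ^ 2 := by rw [← sq, sq_abs]
  rw [h4]
  calc |x + y| ^ (2 + δ) ≤ |x| ^ (2 + δ) + (2 + δ) * |x| ^ δ * x * y +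
        6 * (|x| ^ δ + |y| ^ δ) * |y| * |y| := by linarith
    _ = _ := by rw [mul_assoc _ |y|, h5]; ring

/-! ### Moment inequalities for sums of independent variables. -/

section Moments

variable {Ω : Type*} [MeasurableSpace Ω] {P : Measure Ω} {ι : Type*} {X : ι → Ω → ℝ}

lemma indepFun_sum_smul (hX : ∀ i, Measurable (X i)) (hind : iIndepFun X P) (c : ι → ℝ)
    {s : Finset ι} {i : ι} (hi : i ∉ s) :
    IndepFun (fun ω => ∑ j ∈ s, c j * X j ω) (fun ω => c i * X i ω) P := by
  have h1 : iIndepFun (fun j ω => c j * X j ω) P :=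
    hind.comp (fun j x => c j * x) (fun j => by fun_prop)
  have := h1.indepFun_finsetSum_of_notMem (fun j => (hX j).const_mul (c j)) hi
  convert this using 1
  ext ω; simp

variable [IsProbabilityMeasure P]

lemma integrable_abs_rpow {p t : ℝ} (ht : 0 ≤ t) (htp : t ≤ p) {S : Ω → ℝ}
    (hS : MemLp S (ENNReal.ofReal p) P) : Integrable (fun ω => |S ω| ^ t) P := by
  rcases ht.eq_or_lt with rfl | ht0
  · simp
  · have h1 : MemLp S (ENNReal.ofReal t) P := hS.mono_exponent (ENNReal.ofReal_le_ofReal htp)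
    have := h1.integrable_norm_rpow (by simpa using ht0) ENNReal.ofReal_ne_top
    simpa [ENNReal.toReal_ofReal ht] using this

lemma integrable_signed_rpow {p t : ℝ} (ht : 0 < t) (htp : t ≤ p) {S : Ω → ℝ} (hm : Measurable S)
    (hS : MemLp S (ENNReal.ofReal p) P) : Integrable (fun ω => |S ω| ^ (t - 1) * S ω) P := by
  refine (integrable_abs_rpow ht.le htp hS).mono'
    (by fun_prop) (Eventually.of_forall fun ω => ?_)
  rw [Real.norm_eq_abs, abs_mul, abs_of_nonneg (Real.rpow_nonneg (abs_nonneg _) _)]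
  have := abs_rpow_sub_one_mul_self ht (abs_nonneg (S ω))
  rw [abs_abs] at this
  exact this.le

/-- `|s|^t ≤ 2 r^{t/2}` on average when `E s² ≤ r`. -/
lemma integral_abs_rpow_le {t r : ℝ} (ht0 : 0 ≤ t) (ht2 : t ≤ 2) {S : Ω → ℝ}
    (hS : MemLp S 2 P) (hr : ∫ ω, S ω ^ 2 ∂P ≤ r) (hr0 : 0 < r) :
    ∫ ω, |S ω| ^ t ∂P ≤ 2 * r ^ (t / 2) := by
  have hS' : MemLp S (ENNReal.ofReal 2) P := by simpa using hS
  have h0 : 0 < r ^ (t / 2) := Real.rpow_pos_of_pos hr0 _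
  -- The first term dominates when `s² ≤ r`, the second when `s² ≥ r`, because `t/2 ≤ 1`.
  have hpt : ∀ s : ℝ, |s| ^ t ≤ r ^ (t / 2) + r ^ (t / 2) / r * s ^ 2 := by
    intro s
    rcases le_total (s ^ 2) r with h | h
    · have h1 : |s| ^ t = (s ^ 2) ^ (t / 2) := by
        rw [← sq_abs, ← Real.rpow_natCast, ← Real.rpow_mul (abs_nonneg s)]; congr 1; simp; ring
      have h2 := Real.rpow_le_rpow (sq_nonneg s) h (by linarith : 0 ≤ t / 2)
      have : 0 ≤ r ^ (t / 2) / r * s ^ 2 := by positivity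
      linarith
    · have h1 : |s| ^ t = r ^ (t / 2) * (s ^ 2 / r) ^ (t / 2) := by
        rw [← Real.mul_rpow hr0.le (by positivity), mul_div_cancel₀ _ hr0.ne', ← sq_abs,
          ← Real.rpow_natCast, ← Real.rpow_mul (abs_nonneg s)]
        congr 1; simp; ring
      have h2 : (s ^ 2 / r) ^ (t / 2) ≤ s ^ 2 / r := by
        have := Real.rpow_le_rpow_of_exponent_le ((one_le_div hr0).2 h) (by linarith : t / 2 ≤ 1)
        simpa using this
      rw [h1]
      calc r ^ (t / 2) * (s ^ 2 / r) ^ (t / 2) ≤ r ^ (t / 2) * (s ^ 2 / r) := by gcongr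
        _ = r ^ (t / 2) / r * s ^ 2 := by ring
        _ ≤ _ := by linarith
  have hi : Integrable (fun ω => r ^ (t / 2) / r * S ω ^ 2) P := hS.integrable_sq.const_mul _
  calc ∫ ω, |S ω| ^ t ∂P ≤ ∫ ω, (r ^ (t / 2) + r ^ (t / 2) / r * S ω ^ 2) ∂P :=
        integral_mono (integrable_abs_rpow ht0 ht2 hS') ((integrable_const _).add hi)
          fun ω => hpt _
    _ = r ^ (t / 2) + r ^ (t / 2) / r * ∫ ω, S ω ^ 2 ∂P := by
        rw [integral_add (integrable_const _) hi, integral_const_mul]; simp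
    _ ≤ r ^ (t / 2) + r ^ (t / 2) / r * r := by gcongr
    _ = _ := by rw [div_mul_cancel₀ _ hr0.ne']; ring

lemma integral_abs_add_rpow_le_of_le_two {q : ℝ} (hq1 : 1 < q) (hq2 : q ≤ 2) {S Z : Ω → ℝ}
    (hS : Measurable S) (hSq : MemLp S (ENNReal.ofReal q) P)
    (hZq : MemLp Z (ENNReal.ofReal q) P) (hind : IndepFun S Z P) (hZ0 : ∫ ω, Z ω ∂P = 0) :
    ∫ ω, |S ω + Z ω| ^ q ∂P ≤ ∫ ω, |S ω| ^ q ∂P + 4 * ∫ ω, |Z ω| ^ q ∂P := by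
  have hq0 : 0 ≤ q := by linarith
  have i1 := integrable_abs_rpow hq0 le_rfl hSq
  have i2 := (integrable_abs_rpow hq0 le_rfl hZq).const_mul 4
  have i3 : Integrable (fun ω => |S ω| ^ (q - 2) * S ω) P := by
    have := integrable_signed_rpow (by linarith : 0 < q - 1) (by linarith : q - 1 ≤ q) hS hSq
    rwa [show q - 1 - 1 = q - 2 by ring] at this
  have i4 : Integrable Z P := hZq.integrable (by
    rw [← ENNReal.ofReal_one]; exact ENNReal.ofReal_le_ofReal hq1.le)
  have hind' : IndepFun (fun ω => |S ω| ^ (q - 2) * S ω) Z P :=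
    hind.comp (φ := fun s => |s| ^ (q - 2) * s) (ψ := id) (by fun_prop) measurable_id
  have i5 : Integrable (fun ω => |S ω| ^ (q - 2) * S ω * Z ω) P := hind'.integrable_mul i3 i4
  have e5 : ∫ ω, |S ω| ^ (q - 2) * S ω * Z ω ∂P = 0 := by
    have := hind'.integral_mul_eq_mul_integral i3.1 i4.1
    simp only [Pi.mul_apply, hZ0, mul_zero] at this
    exact this
  have i6 : Integrable (fun ω => |S ω + Z ω| ^ q) P :=
    integrable_abs_rpow (S := fun ω => S ω + Z ω) hq0 le_rfl (hSq.add hZq)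
  calc ∫ ω, |S ω + Z ω| ^ q ∂P
      ≤ ∫ ω, (|S ω| ^ q + q * (|S ω| ^ (q - 2) * S ω * Z ω) + 4 * |Z ω| ^ q) ∂P :=
        integral_mono i6 ((i1.fun_add (i5.const_mul q)).fun_add i2) fun ω => by
          have := abs_add_rpow_le_of_le_two hq1 hq2 (S ω) (Z ω)
          simp only; linarith
    _ = _ := by
        rw [integral_add (i1.fun_add (i5.const_mul q)) i2, integral_add i1 (i5.const_mul q),
          integral_const_mul, integral_const_mul, e5]
        ring

lemma integral_abs_add_rpow_le_of_le_three {δ : ℝ} (hδ0 : 0 < δ) (hδ1 : δ ≤ 1) {S Z : Ω → ℝ}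
    (hS : Measurable S) (hSp : MemLp S (ENNReal.ofReal (2 + δ)) P)
    (hZp : MemLp Z (ENNReal.ofReal (2 + δ)) P) (hind : IndepFun S Z P)
    (hZ0 : ∫ ω, Z ω ∂P = 0) :
    ∫ ω, |S ω + Z ω| ^ (2 + δ) ∂P ≤ ∫ ω, |S ω| ^ (2 + δ) ∂P +
      6 * ((∫ ω, |S ω| ^ δ ∂P) * (∫ ω, Z ω ^ 2 ∂P) + ∫ ω, |Z ω| ^ (2 + δ) ∂P) := by
  have hp0 : 0 ≤ 2 + δ := by linarith
  have i1 := integrable_abs_rpow hp0 le_rfl hSp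
  have i2 := integrable_abs_rpow hp0 le_rfl hZp
  have i3 : Integrable (fun ω => |S ω| ^ δ * S ω) P := by
    have := integrable_signed_rpow (by linarith : 0 < 1 + δ) (by linarith : 1 + δ ≤ 2 + δ) hS hSp
    rwa [add_sub_cancel_left] at this
  have hZ2 : MemLp Z 2 P := hZp.mono_exponent (by
    rw [← ENNReal.ofReal_ofNat]; exact ENNReal.ofReal_le_ofReal (by linarith))
  have i4 : Integrable Z P := hZ2.integrable (by norm_num)
  have hind' : IndepFun (fun ω => |S ω| ^ δ * S ω) Z P :=
    hind.comp (φ := fun s => |s| ^ δ * s) (ψ := id) (by fun_prop) measurable_id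
  have i5 : Integrable (fun ω => |S ω| ^ δ * S ω * Z ω) P := hind'.integrable_mul i3 i4
  have e5 : ∫ ω, |S ω| ^ δ * S ω * Z ω ∂P = 0 := by
    have := hind'.integral_mul_eq_mul_integral i3.1 i4.1
    simp only [Pi.mul_apply, hZ0, mul_zero] at this
    exact this
  have i6 : Integrable (fun ω => |S ω + Z ω| ^ (2 + δ)) P :=
    integrable_abs_rpow (S := fun ω => S ω + Z ω) hp0 le_rfl (hSp.add hZp)
  have i7 := integrable_abs_rpow hδ0.le (by linarith : δ ≤ 2 + δ) hSp
  have hind2 : IndepFun (fun ω => |S ω| ^ δ) (fun ω => Z ω ^ 2) P :=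
    hind.comp (φ := fun s => |s| ^ δ) (ψ := fun z => z ^ 2) (by fun_prop) (by fun_prop)
  have i8 : Integrable (fun ω => |S ω| ^ δ * Z ω ^ 2) P := hind2.integrable_mul i7 hZ2.integrable_sq
  have e8 : ∫ ω, |S ω| ^ δ * Z ω ^ 2 ∂P = (∫ ω, |S ω| ^ δ ∂P) * ∫ ω, Z ω ^ 2 ∂P :=
    hind2.integral_mul_eq_mul_integral i7.1 hZ2.integrable_sq.1
  calc ∫ ω, |S ω + Z ω| ^ (2 + δ) ∂P
      ≤ ∫ ω, (|S ω| ^ (2 + δ) + (2 + δ) * (|S ω| ^ δ * S ω * Z ω) +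
          6 * (|S ω| ^ δ * Z ω ^ 2 + |Z ω| ^ (2 + δ))) ∂P :=
        integral_mono i6 ((i1.fun_add (i5.const_mul _)).fun_add ((i8.fun_add i2).const_mul 6)) fun ω => by
          have := abs_add_rpow_le_of_le_three hδ0 hδ1 (S ω) (Z ω)
          simp only; linarith
    _ = _ := by
        rw [integral_add (i1.fun_add (i5.const_mul _)) ((i8.fun_add i2).const_mul 6),
          integral_add i1 (i5.const_mul _), integral_const_mul, integral_const_mul,
          integral_add i8 i2, e5, e8]
        ring

/-- A von Bahr–Esseen inequality. -/
lemma integral_abs_sum_rpow_le_of_le_two {q : ℝ} (hq1 : 1 < q) (hq2 : q ≤ 2)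
    (hX : ∀ i, Measurable (X i)) (hind : iIndepFun X P)
    (hXq : ∀ i, MemLp (X i) (ENNReal.ofReal q) P) (hX0 : ∀ i, ∫ ω, X i ω ∂P = 0) {B : ℝ}
    (hB : ∀ i, ∫ ω, |X i ω| ^ q ∂P ≤ B) (c : ι → ℝ) (s : Finset ι) :
    ∫ ω, |∑ i ∈ s, c i * X i ω| ^ q ∂P ≤ 4 * B * ∑ i ∈ s, |c i| ^ q := by
  classical
  induction s using Finset.induction_on with
  | empty => simp [Real.zero_rpow (by linarith : q ≠ 0)]
  | insert i s hi ih =>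
    have hstep := integral_abs_add_rpow_le_of_le_two hq1 hq2
      (S := fun ω => ∑ j ∈ s, c j * X j ω) (Z := fun ω => c i * X i ω)
      (Finset.measurable_fun_sum _ fun j _ => (hX j).const_mul (c j))
      (memLp_finsetSum _ fun j _ => (hXq j).const_mul (c j)) ((hXq i).const_mul (c i))
      (indepFun_sum_smul hX hind c hi) (by rw [integral_const_mul, hX0, mul_zero])
    have h2 : ∫ ω, |c i * X i ω| ^ q ∂P ≤ |c i| ^ q * B := by
      -- Each inserted variable adds at most `4 B |c_i|^q`; the cross term has vanished by
      -- independence.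
      have : ∀ ω, |c i * X i ω| ^ q = |c i| ^ q * |X i ω| ^ q := fun ω => by
        rw [abs_mul, Real.mul_rpow (abs_nonneg _) (abs_nonneg _)]
      simp only [this]
      rw [integral_const_mul]
      exact mul_le_mul_of_nonneg_left (hB i) (by positivity)
    simp only [Finset.sum_insert hi]
    simp only [add_comm (c i * X i _)]
    linarith

/-- A Marcinkiewicz–Zygmund inequality for linear forms in variables of unit variance. -/
lemma integral_abs_sum_rpow_le_of_le_three {δ : ℝ} (hδ0 : 0 < δ) (hδ1 : δ ≤ 1)
    (hX : ∀ i, Measurable (X i)) (hind : iIndepFun X P)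
    (hXp : ∀ i, MemLp (X i) (ENNReal.ofReal (2 + δ)) P) (hX0 : ∀ i, ∫ ω, X i ω ∂P = 0)
    (hX2 : ∀ i, ∫ ω, X i ω ^ 2 ∂P = 1) {M : ℝ}
    (hM : ∀ i, ∫ ω, |X i ω| ^ (2 + δ) ∂P ≤ M) (c : ι → ℝ) {r : ℝ} (hr0 : 0 < r)
    (s : Finset ι) (hs : ∑ i ∈ s, c i ^ 2 ≤ r)
    (hvar : ∀ t ⊆ s, ∫ ω, (∑ i ∈ t, c i * X i ω) ^ 2 ∂P ≤ r) :
    ∫ ω, |∑ i ∈ s, c i * X i ω| ^ (2 + δ) ∂P ≤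
      6 * (2 + M) * r ^ (δ / 2) * ∑ i ∈ s, c i ^ 2 := by
  classical
  have hrδ : 0 < r ^ (δ / 2) := Real.rpow_pos_of_pos hr0 _
  induction s using Finset.induction_on with
  | empty => simp [Real.zero_rpow (by linarith : 2 + δ ≠ 0)]
  | insert i s hi ih =>
    rw [Finset.sum_insert hi] at hs
    have hsub : s ⊆ insert i s := Finset.subset_insert i s
    have ih' := ih (by nlinarith [sq_nonneg (c i)]) fun t ht => hvar t (ht.trans hsub)
    have hSp : MemLp (fun ω => ∑ j ∈ s, c j * X j ω) (ENNReal.ofReal (2 + δ)) P :=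
      memLp_finsetSum _ fun j _ => (hXp j).const_mul (c j)
    have hstep := integral_abs_add_rpow_le_of_le_three hδ0 hδ1
      (S := fun ω => ∑ j ∈ s, c j * X j ω) (Z := fun ω => c i * X i ω)
      (Finset.measurable_fun_sum _ fun j _ => (hX j).const_mul (c j))
      hSp ((hXp i).const_mul (c i))
      (indepFun_sum_smul hX hind c hi) (by rw [integral_const_mul, hX0, mul_zero])
    have h2 : ∫ ω, |c i * X i ω| ^ (2 + δ) ∂P ≤ r ^ (δ / 2) * c i ^ 2 * M := by
      have : ∀ ω, |c i * X i ω| ^ (2 + δ) = |c i| ^ (2 + δ) * |X i ω| ^ (2 + δ) := fun ω => by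
        rw [abs_mul, Real.mul_rpow (abs_nonneg _) (abs_nonneg _)]
      simp only [this]
      rw [integral_const_mul]
      have h3 : |c i| ^ (2 + δ) ≤ r ^ (δ / 2) * c i ^ 2 := by
        have h4 : |c i| ^ δ ≤ r ^ (δ / 2) := by
          have h5 : c i ^ 2 ≤ r := by
            have : 0 ≤ ∑ j ∈ s, c j ^ 2 := Finset.sum_nonneg fun j _ => sq_nonneg _
            linarith
          have h6 := Real.rpow_le_rpow (sq_nonneg (c i)) h5 (by linarith : 0 ≤ δ / 2)
          rwa [← sq_abs, ← Real.rpow_natCast, ← Real.rpow_mul (abs_nonneg _),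
            show ((2 : ℕ) : ℝ) * (δ / 2) = δ by push_cast; ring] at h6
        rw [add_comm, Real.rpow_add_of_nonneg (abs_nonneg _) hδ0.le zero_le_two, Real.rpow_two,
          sq_abs]
        gcongr
      have h0 : 0 ≤ ∫ ω, |X i ω| ^ (2 + δ) ∂P := integral_nonneg fun ω => by positivity
      exact mul_le_mul h3 (hM i) h0 (by positivity)
    have h7 : ∫ ω, (c i * X i ω) ^ 2 ∂P = c i ^ 2 := by
      simp only [mul_pow]
      rw [integral_const_mul, hX2, mul_one]
    -- The bound on the second moment of every partial sum, not only of the full one, is needed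
    -- here. The increment is then at most `6 (2 + M) r^(δ/2) c_i²`.
    have h8 : ∫ ω, |∑ j ∈ s, c j * X j ω| ^ δ ∂P ≤ 2 * r ^ (δ / 2) :=
      integral_abs_rpow_le hδ0.le (by linarith) (hSp.mono_exponent (by
        rw [← ENNReal.ofReal_ofNat]; exact ENNReal.ofReal_le_ofReal (by linarith)))
        (hvar s hsub) hr0
    simp only [Finset.sum_insert hi]
    simp only [add_comm (c i * X i _)]
    rw [h7] at hstep
    have h9 := mul_le_mul_of_nonneg_right h8 (sq_nonneg (c i))
    linarith

end Moments

/-! ### Young's inequality and the expansion in a single coordinate. -/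

lemma abs_rpow_two_add {δ : ℝ} (hδ0 : 0 < δ) (x : ℝ) : |x| ^ (2 + δ) = |x| ^ δ * x ^ 2 := by
  rw [add_comm, Real.rpow_add_of_nonneg (abs_nonneg _) hδ0.le zero_le_two, Real.rpow_two, sq_abs]

/-- The exponents `(2+δ)/δ` and `(2+δ)/2` are conjugate; comparing `b` with `l a²` shows which term
dominates. The weight `l` stays free so that it can be optimised after summation. -/
lemma rpow_mul_le_young {δ l a b : ℝ} (hδ0 : 0 < δ) (hl : 0 < l) (ha : 0 ≤ a) (hb : 0 ≤ b) :
    a ^ δ * b ≤ l * a ^ (2 + δ) + l ^ (-(δ / 2)) * b ^ ((2 + δ) / 2) := by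
  rcases le_total b (l * a ^ 2) with h | h
  · have h1 : a ^ δ * b ≤ l * a ^ (2 + δ) := by
      have := abs_rpow_two_add hδ0 a
      rw [abs_of_nonneg ha] at this
      rw [this]
      have := mul_le_mul_of_nonneg_left h (Real.rpow_nonneg ha δ)
      linarith
    have : 0 ≤ l ^ (-(δ / 2)) * b ^ ((2 + δ) / 2) := by positivity
    linarith
  · have h1 : a ^ δ ≤ l ^ (-(δ / 2)) * b ^ (δ / 2) := by
      have h2 : a ^ 2 ≤ l⁻¹ * b := by
        rw [inv_mul_eq_div, le_div_iff₀ hl]; linarith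
      have h3 := Real.rpow_le_rpow (sq_nonneg a) h2 (by linarith : 0 ≤ δ / 2)
      rwa [← Real.rpow_natCast, ← Real.rpow_mul ha,
        show ((2 : ℕ) : ℝ) * (δ / 2) = δ by push_cast; ring,
        Real.mul_rpow (inv_nonneg.2 hl.le) hb, Real.inv_rpow hl.le, ← Real.rpow_neg hl.le] at h3
    have h4 : b ^ ((2 + δ) / 2) = b ^ (δ / 2) * b := by
      rw [show (2 + δ) / 2 = δ / 2 + 1 by ring, Real.rpow_add_of_nonneg hb (by linarith) zero_le_one,
        Real.rpow_one]
    have h5 := mul_le_mul_of_nonneg_right h1 hb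
    have : 0 ≤ l * a ^ (2 + δ) := by positivity
    rw [h4]
    linarith

section Core

variable {Ω : Type*} [MeasurableSpace Ω] {P : Measure Ω}

lemma integrable_fun_sub {g k : Ω → ℝ} (hg : Integrable g P) (hk : Integrable k P) :
    Integrable (fun ω => g ω - k ω) P :=
  hg.sub hk

lemma IndepFun.integrable_mul_and_integral {β : Type*} [MeasurableSpace β] {x : Ω → ℝ} {V : Ω → β}
    (h : IndepFun x V P) {φ : ℝ → ℝ} {ψ : β → ℝ} (hφ : Measurable φ) (hψ : Measurable ψ)
    (i1 : Integrable (fun ω => φ (x ω)) P) (i2 : Integrable (fun ω => ψ (V ω)) P) :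
    Integrable (fun ω => φ (x ω) * ψ (V ω)) P ∧
      ∫ ω, φ (x ω) * ψ (V ω) ∂P = (∫ ω, φ (x ω) ∂P) * ∫ ω, ψ (V ω) ∂P :=
  have h' : IndepFun (fun ω => φ (x ω)) (fun ω => ψ (V ω)) P := h.comp hφ hψ
  ⟨h'.integrable_mul i1 i2, h'.integral_mul_eq_mul_integral i1.1 i2.1⟩

lemma integrable_mul_of_abs_le {g k : Ω → ℝ} {B : ℝ} (hg : Integrable g P) (hk : Measurable k)
    (hB : ∀ ω, |k ω| ≤ B) : Integrable (fun ω => g ω * k ω) P :=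
  hg.mul_bdd hk.aestronglyMeasurable (Eventually.of_forall hB)

variable [IsProbabilityMeasure P] {δ M : ℝ} {x s w y : Ω → ℝ} {f f' : ℝ → ℝ}

/-- First-order expansion of `E[x s f(w + x s)]` when `x` is standardized and independent of
`(s, w)`. -/
lemma abs_integral_mul_sub_le (hδ0 : 0 < δ) (hδ1 : δ ≤ 1) (hx : Measurable x) (hs : Measurable s)
    (hw : Measurable w) (hind : IndepFun x (fun ω => (s ω, w ω)) P)
    (hxp : MemLp x (ENNReal.ofReal (2 + δ)) P) (hsp : MemLp s (ENNReal.ofReal (2 + δ)) P)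
    (hx0 : ∫ ω, x ω ∂P = 0) (hx2 : ∫ ω, x ω ^ 2 ∂P = 1) (hM : ∫ ω, |x ω| ^ (2 + δ) ∂P ≤ M)
    (hf : ∀ z, HasDerivAt f (f' z) z) (hf3 : ∀ z, |f z| ≤ 3) (hf8 : ∀ z, |f' z| ≤ 8)
    (hfc : Continuous f') (hfδ : ∀ a b, |f' a - f' b| ≤ 16 * |a - b| ^ δ) :
    |∫ ω, x ω * s ω * f (w ω + x ω * s ω) ∂P - ∫ ω, s ω ^ 2 * f' (w ω + x ω * s ω) ∂P| ≤
      16 * (M + 2) * ∫ ω, |s ω| ^ (2 + δ) ∂P := by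
  have h2 : (2 : ℝ≥0∞) ≤ ENNReal.ofReal (2 + δ) := by
    rw [← ENNReal.ofReal_ofNat]; exact ENNReal.ofReal_le_ofReal (by linarith)
  have hfcont : Continuous f := continuous_iff_continuousAt.2 fun z => (hf z).continuousAt
  have hfm : Measurable f := hfcont.measurable
  have hfm' : Measurable f' := hfc.measurable
  have hx2' := hxp.mono_exponent h2
  have hs2' := hsp.mono_exponent h2
  have ix := hx2'.integrable (by norm_num)
  have is := hs2'.integrable (by norm_num)
  have ixx := hx2'.integrable_sq
  have iss := hs2'.integrable_sq
  have ixp := integrable_abs_rpow (by linarith) le_rfl hxp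
  have isp := integrable_abs_rpow (by linarith) le_rfl hsp
  have ixδ := integrable_abs_rpow hδ0.le (by linarith : δ ≤ 2 + δ) hxp
  have exδ : ∫ ω, |x ω| ^ δ ∂P ≤ 2 := by
    simpa using integral_abs_rpow_le hδ0.le (by linarith : δ ≤ 2) hx2' hx2.le one_pos
  obtain ⟨jxs, -⟩ := IndepFun.integrable_mul_and_integral hind (φ := id) (ψ := fun v => v.1)
    measurable_id measurable_fst ix is
  have j1 : Integrable (fun ω => x ω * s ω * f (w ω + x ω * s ω)) P :=
    integrable_mul_of_abs_le jxs (by fun_prop) fun ω => hf3 _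
  have j2 : Integrable (fun ω => s ω ^ 2 * f' (w ω + x ω * s ω)) P :=
    integrable_mul_of_abs_le iss (by fun_prop) fun ω => hf8 _
  obtain ⟨j3, e3⟩ := IndepFun.integrable_mul_and_integral hind (φ := id)
    (ψ := fun v => v.1 * f v.2) measurable_id (by fun_prop) ix
    (integrable_mul_of_abs_le is (by fun_prop) fun ω => hf3 _)
  obtain ⟨j4, e4⟩ := IndepFun.integrable_mul_and_integral hind (φ := fun x => x ^ 2 - 1)
    (ψ := fun v => v.1 ^ 2 * f' v.2) (by fun_prop) (by fun_prop) (ixx.sub (integrable_const 1))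
    (integrable_mul_of_abs_le iss (by fun_prop) fun ω => hf8 _)
  obtain ⟨j5, e5⟩ := IndepFun.integrable_mul_and_integral hind (φ := fun x => |x| ^ (2 + δ))
    (ψ := fun v => |v.1| ^ (2 + δ)) (by fun_prop) (by fun_prop) ixp isp
  obtain ⟨j6, e6⟩ := IndepFun.integrable_mul_and_integral hind (φ := fun x => |x| ^ δ)
    (ψ := fun v => |v.1| ^ (2 + δ)) (by fun_prop) (by fun_prop) ixδ isp
  have ex21 : ∫ ω, (x ω ^ 2 - 1) ∂P = 0 := by
    rw [integral_sub ixx (integrable_const 1), hx2]; simp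
  simp only [id, hx0, zero_mul] at e3 j3
  rw [ex21, zero_mul] at e4
  -- The two subtracted products integrate to zero: each is a centred function of `x` times a
  -- function of `(s, w)`. The remainder is the Taylor error of `f` at `w` plus `s²` times the
  -- increment of `f'`.
  have hpt : ∀ ω, |x ω * s ω * f (w ω + x ω * s ω) - s ω ^ 2 * f' (w ω + x ω * s ω) -
      x ω * (s ω * f (w ω)) - (x ω ^ 2 - 1) * (s ω ^ 2 * f' (w ω))| ≤
      16 * (|x ω| ^ (2 + δ) * |s ω| ^ (2 + δ)) + 16 * (|x ω| ^ δ * |s ω| ^ (2 + δ)) := by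
    intro ω
    set a := x ω
    set b := s ω
    set c := w ω
    have t1 := abs_taylor_le hf (x := c) (y := a * b) (B := 16 * |a * b| ^ δ) fun z hz =>
      (hfδ z c).trans (by gcongr)
    have t2 := hfδ (c + a * b) c
    rw [add_sub_cancel_left] at t2
    have hab : |a * b| ^ δ = |a| ^ δ * |b| ^ δ := by
      rw [abs_mul, Real.mul_rpow (abs_nonneg _) (abs_nonneg _)]
    calc |a * b * f (c + a * b) - b ^ 2 * f' (c + a * b) - a * (b * f c) -
          (a ^ 2 - 1) * (b ^ 2 * f' c)|
        = |a * b * (f (c + a * b) - f c - f' c * (a * b)) - b ^ 2 * (f' (c + a * b) - f' c)| := by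
          congr 1; ring
      _ ≤ |a * b| * |f (c + a * b) - f c - f' c * (a * b)| + b ^ 2 * |f' (c + a * b) - f' c| := by
          refine (abs_sub _ _).trans ?_
          rw [abs_mul, abs_mul (b ^ 2), abs_of_nonneg (sq_nonneg b)]
      _ ≤ |a * b| * (16 * |a * b| ^ δ * |a * b|) + b ^ 2 * (16 * |a * b| ^ δ) := by gcongr
      _ = 16 * |a * b| ^ δ * (a * b) ^ 2 + b ^ 2 * (16 * |a * b| ^ δ) := by
          rw [← sq_abs (a * b)]; ring
      _ = _ := by
          rw [abs_rpow_two_add hδ0 a, abs_rpow_two_add hδ0 b, hab]; ring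
  have hE : ∫ ω, (x ω * s ω * f (w ω + x ω * s ω) - s ω ^ 2 * f' (w ω + x ω * s ω) -
      x ω * (s ω * f (w ω)) - (x ω ^ 2 - 1) * (s ω ^ 2 * f' (w ω))) ∂P =
      ∫ ω, x ω * s ω * f (w ω + x ω * s ω) ∂P - ∫ ω, s ω ^ 2 * f' (w ω + x ω * s ω) ∂P := by
    rw [integral_sub (integrable_fun_sub (integrable_fun_sub j1 j2) j3) j4, integral_sub (integrable_fun_sub j1 j2) j3,
      integral_sub j1 j2, e3, e4]
    ring
  rw [← hE]
  refine abs_integral_le_integral_abs.trans ?_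
  have hsp0 : 0 ≤ ∫ ω, |s ω| ^ (2 + δ) ∂P := integral_nonneg fun ω => by positivity
  calc _ ≤ ∫ ω, (16 * (|x ω| ^ (2 + δ) * |s ω| ^ (2 + δ)) +
          16 * (|x ω| ^ δ * |s ω| ^ (2 + δ))) ∂P :=
        integral_mono (integrable_fun_sub (integrable_fun_sub (integrable_fun_sub j1 j2) j3) j4).abs
          ((j5.const_mul 16).fun_add (j6.const_mul 16)) hpt
    _ = 16 * ((∫ ω, |x ω| ^ (2 + δ) ∂P) * ∫ ω, |s ω| ^ (2 + δ) ∂P) +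
          16 * ((∫ ω, |x ω| ^ δ ∂P) * ∫ ω, |s ω| ^ (2 + δ) ∂P) := by
        rw [integral_add (j5.const_mul 16) (j6.const_mul 16), integral_const_mul,
          integral_const_mul, e5, e6]
    _ ≤ 16 * (M * ∫ ω, |s ω| ^ (2 + δ) ∂P) + 16 * (2 * ∫ ω, |s ω| ^ (2 + δ) ∂P) := by gcongr
    _ = _ := by ring

lemma integrable_rpow_mul (hδ0 : 0 < δ) (hs : Measurable s) (hy : Measurable y)
    (hsp : MemLp s (ENNReal.ofReal (2 + δ)) P) (hyq : MemLp y (ENNReal.ofReal ((2 + δ) / 2)) P) :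
    Integrable (fun ω => |s ω| ^ δ * |y ω|) P := by
  have isp := integrable_abs_rpow (by linarith) le_rfl hsp
  have iyq := integrable_abs_rpow (by linarith) le_rfl hyq
  refine (isp.fun_add iyq).mono' (by fun_prop) (Eventually.of_forall fun ω => ?_)
  have := rpow_mul_le_young hδ0 one_pos (abs_nonneg (s ω)) (abs_nonneg (y ω))
  rw [Real.norm_eq_abs, abs_of_nonneg (by positivity)]
  simpa using this

/-- Decorrelation of `f'(w + x s)` from the centred quadratic `b (x² - 1) + x y` when `x` is
standardized and independent of `(s, w, y)`. -/
lemma abs_integral_mul_centred_le (hδ0 : 0 < δ) (hδ1 : δ ≤ 1) (hx : Measurable x)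
    (hs : Measurable s) (hw : Measurable w) (hy : Measurable y)
    (hind : IndepFun x (fun ω => (s ω, w ω, y ω)) P)
    (hxp : MemLp x (ENNReal.ofReal (2 + δ)) P) (hsp : MemLp s (ENNReal.ofReal (2 + δ)) P)
    (hyq : MemLp y (ENNReal.ofReal ((2 + δ) / 2)) P)
    (hx0 : ∫ ω, x ω ∂P = 0) (hx2 : ∫ ω, x ω ^ 2 ∂P = 1) (hM : ∫ ω, |x ω| ^ (2 + δ) ∂P ≤ M)
    (hf8 : ∀ z, |f' z| ≤ 8) (hfc : Continuous f')
    (hfδ : ∀ a b, |f' a - f' b| ≤ 16 * |a - b| ^ δ) {b : ℝ} (hb : 0 ≤ b) :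
    Integrable (fun ω => (b * (x ω ^ 2 - 1) + x ω * y ω) * f' (w ω + x ω * s ω)) P ∧
    |∫ ω, (b * (x ω ^ 2 - 1) + x ω * y ω) * f' (w ω + x ω * s ω) ∂P| ≤
      16 * (b * (M + 2) * ∫ ω, |s ω| ^ δ ∂P + 2 * ∫ ω, |s ω| ^ δ * |y ω| ∂P) := by
  have h2 : (2 : ℝ≥0∞) ≤ ENNReal.ofReal (2 + δ) := by
    rw [← ENNReal.ofReal_ofNat]; exact ENNReal.ofReal_le_ofReal (by linarith)
  have h1 : (1 : ℝ≥0∞) ≤ ENNReal.ofReal ((2 + δ) / 2) := by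
    rw [← ENNReal.ofReal_one]; exact ENNReal.ofReal_le_ofReal (by linarith)
  have hfm' : Measurable f' := hfc.measurable
  have hx2' := hxp.mono_exponent h2
  have hs2' := hsp.mono_exponent h2
  have ix := hx2'.integrable (by norm_num)
  have iy := hyq.integrable h1
  have ixx := hx2'.integrable_sq
  have ixp := integrable_abs_rpow (by linarith) le_rfl hxp
  have isδ := integrable_abs_rpow hδ0.le (by linarith : δ ≤ 2 + δ) hsp
  have ixδ := integrable_abs_rpow hδ0.le (by linarith : δ ≤ 2 + δ) hxp
  have ixδ1 := integrable_abs_rpow (by linarith) (by linarith : 1 + δ ≤ 2 + δ) hxp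
  have isy := integrable_rpow_mul hδ0 hs hy hsp hyq
  have exδ : ∫ ω, |x ω| ^ δ ∂P ≤ 2 := by
    simpa using integral_abs_rpow_le hδ0.le (by linarith : δ ≤ 2) hx2' hx2.le one_pos
  have exδ1 : ∫ ω, |x ω| ^ (1 + δ) ∂P ≤ 2 := by
    simpa using integral_abs_rpow_le (by linarith) (by linarith : 1 + δ ≤ 2) hx2' hx2.le one_pos
  obtain ⟨jxy, -⟩ := IndepFun.integrable_mul_and_integral hind (φ := id) (ψ := fun v => v.2.2)
    measurable_id (by fun_prop) ix iy
  simp only [id] at jxy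
  have j1 : Integrable (fun ω => (b * (x ω ^ 2 - 1) + x ω * y ω) * f' (w ω + x ω * s ω)) P :=
    integrable_mul_of_abs_le (((ixx.sub (integrable_const 1)).const_mul b).fun_add jxy)
      (by fun_prop) fun ω => hf8 _
  obtain ⟨j3, e3⟩ := IndepFun.integrable_mul_and_integral hind (φ := id)
    (ψ := fun v => v.2.2 * f' v.2.1) measurable_id (by fun_prop) ix
    (integrable_mul_of_abs_le iy (by fun_prop) fun ω => hf8 _)
  obtain ⟨j4, e4⟩ := IndepFun.integrable_mul_and_integral hind (φ := fun x => x ^ 2 - 1)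
    (ψ := fun v => b * f' v.2.1) (by fun_prop) (by fun_prop) (ixx.sub (integrable_const 1))
    (integrable_mul_of_abs_le (integrable_const b) (by fun_prop) fun ω => hf8 _)
  obtain ⟨j5, e5⟩ := IndepFun.integrable_mul_and_integral hind
    (φ := fun x => |x| ^ (2 + δ) + |x| ^ δ)
    (ψ := fun v => |v.1| ^ δ) (by fun_prop) (by fun_prop) (ixp.fun_add ixδ) isδ
  obtain ⟨j6, e6⟩ := IndepFun.integrable_mul_and_integral hind (φ := fun x => |x| ^ (1 + δ))
    (ψ := fun v => |v.1| ^ δ * |v.2.2|) (by fun_prop) (by fun_prop) ixδ1 isy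
  have ex21 : ∫ ω, (x ω ^ 2 - 1) ∂P = 0 := by
    rw [integral_sub ixx (integrable_const 1), hx2]; simp
  simp only [id, hx0, zero_mul] at e3 j3
  rw [ex21, zero_mul] at e4
  rw [integral_add ixp ixδ] at e5
  -- Subtracting the same quadratic times `f' w`, which has mean zero, leaves only the increment of
  -- `f'`, of size `16 |x s|^δ`.
  have hpt : ∀ ω, |(b * (x ω ^ 2 - 1) + x ω * y ω) * f' (w ω + x ω * s ω) -
      x ω * (y ω * f' (w ω)) - (x ω ^ 2 - 1) * (b * f' (w ω))| ≤
      16 * b * ((|x ω| ^ (2 + δ) + |x ω| ^ δ) * |s ω| ^ δ) +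
        16 * (|x ω| ^ (1 + δ) * (|s ω| ^ δ * |y ω|)) := by
    intro ω
    set a := x ω
    set c := s ω
    set d := w ω
    set e := y ω
    have t2 := hfδ (d + a * c) d
    rw [add_sub_cancel_left] at t2
    have hac : |a * c| ^ δ = |a| ^ δ * |c| ^ δ := by
      rw [abs_mul, Real.mul_rpow (abs_nonneg _) (abs_nonneg _)]
    have ha1 : |a| ^ (1 + δ) = |a| ^ δ * |a| := by
      rw [add_comm, Real.rpow_add_of_nonneg (abs_nonneg _) hδ0.le zero_le_one, Real.rpow_one]
    have t3 : |b * (a ^ 2 - 1) + a * e| ≤ b * (a ^ 2 + 1) + |a| * |e| := by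
      refine (abs_add_le _ _).trans ?_
      rw [abs_mul, abs_mul, abs_of_nonneg hb]
      gcongr
      rw [abs_le]; constructor <;> nlinarith [sq_nonneg a]
    calc |(b * (a ^ 2 - 1) + a * e) * f' (d + a * c) - a * (e * f' d) - (a ^ 2 - 1) * (b * f' d)|
        = |b * (a ^ 2 - 1) + a * e| * |f' (d + a * c) - f' d| := by
          rw [← abs_mul]; congr 1; ring
      _ ≤ (b * (a ^ 2 + 1) + |a| * |e|) * (16 * |a * c| ^ δ) := by gcongr
      _ = _ := by rw [abs_rpow_two_add hδ0 a, hac, ha1]; ring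
  have hE : ∫ ω, ((b * (x ω ^ 2 - 1) + x ω * y ω) * f' (w ω + x ω * s ω) -
      x ω * (y ω * f' (w ω)) - (x ω ^ 2 - 1) * (b * f' (w ω))) ∂P =
      ∫ ω, (b * (x ω ^ 2 - 1) + x ω * y ω) * f' (w ω + x ω * s ω) ∂P := by
    rw [integral_sub (integrable_fun_sub j1 j3) j4, integral_sub j1 j3, e3, e4]
    ring
  refine ⟨j1, ?_⟩
  rw [← hE]
  refine abs_integral_le_integral_abs.trans ?_
  have hsδ0 : 0 ≤ ∫ ω, |s ω| ^ δ ∂P := integral_nonneg fun ω => by positivity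
  have hsy0 : 0 ≤ ∫ ω, |s ω| ^ δ * |y ω| ∂P := integral_nonneg fun ω => by positivity
  calc _ ≤ ∫ ω, (16 * b * ((|x ω| ^ (2 + δ) + |x ω| ^ δ) * |s ω| ^ δ) +
        16 * (|x ω| ^ (1 + δ) * (|s ω| ^ δ * |y ω|))) ∂P :=
        integral_mono (integrable_fun_sub (integrable_fun_sub j1 j3) j4).abs
          ((j5.const_mul (16 * b)).fun_add (j6.const_mul 16)) hpt
    _ = 16 * b * ((∫ ω, |x ω| ^ (2 + δ) ∂P + ∫ ω, |x ω| ^ δ ∂P) * ∫ ω, |s ω| ^ δ ∂P) +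
          16 * ((∫ ω, |x ω| ^ (1 + δ) ∂P) * ∫ ω, |s ω| ^ δ * |y ω| ∂P) := by
        rw [integral_add (j5.const_mul (16 * b)) (j6.const_mul 16), integral_const_mul,
          integral_const_mul, e5, e6]
    _ ≤ 16 * b * ((M + 2) * ∫ ω, |s ω| ^ δ ∂P) + 16 * (2 * ∫ ω, |s ω| ^ δ * |y ω| ∂P) := by
        gcongr
    _ = _ := by ring

end Core

/-! ### Algebra of the quadratic form and its Gram matrix. -/

section Algebra

variable {n : ℕ} {A : Matrix (Fin n) (Fin n) ℝ}

lemma sum_Ici_eq_half (hA : A.IsSymm) (hA0 : ∀ u, A u u = 0) (x : Fin n → ℝ) :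
    ∑ u, ∑ v ∈ Finset.Ici u, A u v * x u * x v = 1 / 2 * ∑ u, x u * ∑ v, A u v * x v := by
  have h1 : ∀ u : Fin n, ∑ v ∈ Finset.Ici u, A u v * x u * x v =
      ∑ v, if u ≤ v then A u v * x u * x v else 0 := fun u => by
    rw [← Finset.sum_filter]; congr 1; ext v; simp
  have h2 : ∑ u : Fin n, ∑ v, (if u ≤ v then A u v * x u * x v else 0) =
      ∑ u : Fin n, ∑ v, (if v ≤ u then A u v * x u * x v else 0) := by
    rw [Finset.sum_comm]
    refine Finset.sum_congr rfl fun u _ => Finset.sum_congr rfl fun v _ => ?_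
    rw [hA.apply u v]
    split_ifs
    · ring
    · rfl
  have h3 : ∑ u, x u * ∑ v, A u v * x v =
      ∑ u : Fin n, ∑ v, (if u ≤ v then A u v * x u * x v else 0) +
        ∑ u : Fin n, ∑ v, (if v ≤ u then A u v * x u * x v else 0) := by
    rw [← Finset.sum_add_distrib]
    refine Finset.sum_congr rfl fun u _ => ?_
    rw [← Finset.sum_add_distrib, Finset.mul_sum]
    refine Finset.sum_congr rfl fun v _ => ?_
    rcases lt_trichotomy u v with h | rfl | h
    · rw [if_pos h.le, if_neg h.not_ge]; ring
    · simp [hA0]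
    · rw [if_neg h.not_ge, if_pos h.le]; ring
  simp only [h1]
  rw [h3, ← h2]; ring

lemma form_eq_half {Ω : Type*} {X : Fin n → Ω → ℝ} (hA : A.IsSymm) (hA0 : ∀ u, A u u = 0) (ω : Ω) :
    form A X ω = 1 / 2 * ∑ u, X u ω * ∑ v, A u v * X v ω :=
  sum_Ici_eq_half hA hA0 fun i => X i ω

lemma sum_mul_update_zero (hA0 : ∀ u, A u u = 0) (x : Fin n → ℝ) (u : Fin n) :
    ∑ v, A u v * Function.update x u 0 v = ∑ v, A u v * x v := by
  refine Finset.sum_congr rfl fun v _ => ?_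
  rcases eq_or_ne v u with rfl | h
  · simp [hA0]
  · rw [Function.update_of_ne h]

/-- Setting a coordinate to zero stands for removing it: this exhibits `F - X_u S_u` as a function
of the other coordinates. -/
lemma half_sum_update_zero (hA : A.IsSymm) (hA0 : ∀ u, A u u = 0) (x : Fin n → ℝ) (u : Fin n) :
    1 / 2 * ∑ i, Function.update x u 0 i * ∑ j, A i j * Function.update x u 0 j =
      1 / 2 * ∑ i, x i * ∑ j, A i j * x j - x u * ∑ j, A u j * x j := by
  have h1 : ∀ i, Function.update x u 0 i = x i - if i = u then x u else 0 := fun i => by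
    rcases eq_or_ne i u with rfl | h
    · simp
    · rw [Function.update_of_ne h, if_neg h, sub_zero]
  have h2 : ∀ i, ∑ j, A i j * Function.update x u 0 j = ∑ j, A i j * x j - A i u * x u := by
    intro i
    simp only [h1, mul_sub, Finset.sum_sub_distrib, mul_ite, mul_zero, Finset.sum_ite_eq',
      Finset.mem_univ, if_true]
  have h3 : ∑ i, x i * (A i u * x u) = x u * ∑ j, A u j * x j := by
    rw [Finset.mul_sum]
    refine Finset.sum_congr rfl fun i _ => ?_
    rw [hA.apply u i]; ring
  simp only [h2]
  simp only [h1, sub_mul, mul_sub, Finset.sum_sub_distrib, ite_mul, zero_mul, Finset.sum_ite_eq',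
    Finset.mem_univ, if_true, hA0, h3]
  ring

/-- The diagonal and off-diagonal parts of `∑_u (∑_v a_{uv} x_v)²`. -/
lemma sum_row_sq_sub (x : Fin n → ℝ) :
    ∑ u, (∑ v, A u v * x v) ^ 2 - ∑ u, ∑ v, A u v ^ 2 =
      ∑ v, ((∑ k, A k v ^ 2) * (x v ^ 2 - 1) +
        x v * ∑ w, (∑ k, A k v * A k w) * Function.update x v 0 w) := by
  have h1 : ∀ v, ∑ w, (∑ k, A k v * A k w) * Function.update x v 0 w =
      ∑ w, (∑ k, A k v * A k w) * x w - (∑ k, A k v ^ 2) * x v := by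
    intro v
    have h : ∀ i, Function.update x v 0 i = x i - if i = v then x v else 0 := fun i => by
      rcases eq_or_ne i v with rfl | h
      · simp
      · rw [Function.update_of_ne h, if_neg h, sub_zero]
    simp only [h, mul_sub, Finset.sum_sub_distrib, mul_ite, mul_zero, Finset.sum_ite_eq',
      Finset.mem_univ, if_true, ← sq]
  have h2 : ∑ u, (∑ v, A u v * x v) ^ 2 = ∑ v, x v * ∑ w, (∑ k, A k v * A k w) * x w := by
    simp only [sq, Finset.sum_mul, Finset.mul_sum]
    rw [Finset.sum_comm]
    refine Finset.sum_congr rfl fun v _ => ?_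
    rw [Finset.sum_comm]
    refine Finset.sum_congr rfl fun w _ => Finset.sum_congr rfl fun k _ => ?_
    ring
  rw [h2, Finset.sum_comm (f := fun u v => A u v ^ 2), ← Finset.sum_sub_distrib]
  refine Finset.sum_congr rfl fun v _ => ?_
  rw [h1]; ring

lemma rowSum_nonneg (δ : ℝ) (A : Matrix (Fin n) (Fin n) ℝ) : 0 ≤ rowSum δ A :=
  Finset.sum_nonneg fun _ _ => Real.rpow_nonneg (Finset.sum_nonneg fun _ _ => sq_nonneg _) _

lemma sum_abs_gram_le_crossSum (δ : ℝ) (A : Matrix (Fin n) (Fin n) ℝ) :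
    ∑ u, ∑ v, |∑ k, A k u * A k v| ^ ((2 + δ) / 2) ≤ crossSum δ A :=
  le_add_of_nonneg_right (Finset.sum_nonneg fun _ _ => Finset.sum_nonneg fun _ _ =>
    Finset.sum_nonneg fun _ _ => by positivity)

lemma sum_row_sq_eq (hA : A.IsSymm) (v : Fin n) : ∑ k, A k v ^ 2 = ∑ k, A v k ^ 2 :=
  Finset.sum_congr rfl fun k _ => by rw [hA.apply v k]

/-- The diagonal entries of the Gram matrix are the row sums of squares. -/
lemma rowSum_le_crossSum {δ : ℝ} (hA : A.IsSymm) :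
    rowSum δ A ≤ crossSum δ A := by
  refine le_trans ?_ (sum_abs_gram_le_crossSum δ A)
  refine Finset.sum_le_sum fun u _ => ?_
  have : (∑ v, A u v ^ 2) ^ ((2 + δ) / 2) = |∑ k, A k u * A k u| ^ ((2 + δ) / 2) := by
    simp only [← sq, sum_row_sq_eq hA]
    rw [abs_of_nonneg (Finset.sum_nonneg fun _ _ => sq_nonneg _)]
  rw [this]
  exact Finset.single_le_sum (f := fun v => |∑ k, A k u * A k v| ^ ((2 + δ) / 2))
    (fun _ _ => by positivity) (Finset.mem_univ u)

end Algebra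

/-! ### Independence and second moments of the quadratic form. -/

section Standardized

variable {Ω : Type*} [MeasurableSpace Ω] {P : Measure Ω}

/-- Independent, mean zero, variance one and with finite moments of order `2 + δ`. -/
structure Standardized (P : Measure Ω) (δ : ℝ) {n : ℕ} (X : Fin n → Ω → ℝ) : Prop where
  meas : ∀ k, Measurable (X k)
  indep : iIndepFun X P
  memLp : ∀ k, MemLp (X k) (ENNReal.ofReal (2 + δ)) P
  mean : ∀ k, ∫ ω, X k ω ∂P = 0
  mean_sq : ∀ k, ∫ ω, X k ω ^ 2 ∂P = 1

variable {n : ℕ} {X : Fin n → Ω → ℝ} {A : Matrix (Fin n) (Fin n) ℝ} {δ M : ℝ}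

/-- Zeroing coordinate `u` keeps the remaining variables inside `Fin n → ℝ`, so any function of them
can be composed without passing to a subtype. -/
lemma indepFun_update (hX : ∀ k, Measurable (X k)) (hind : iIndepFun X P) (u : Fin n) :
    IndepFun (X u) (fun ω => Function.update (fun i => X i ω) u 0) P := by
  have h := hind.indepFun_finset {u} {u}ᶜ disjoint_compl_right hX
  have hφ : Measurable fun a : ({u} : Finset (Fin n)) → ℝ => a ⟨u, by simp⟩ :=
    measurable_pi_apply _
  have hψ : Measurable fun (b : ({u}ᶜ : Finset (Fin n)) → ℝ) (i : Fin n) =>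
      if h : i = u then (0 : ℝ) else b ⟨i, by simpa using h⟩ :=
    measurable_pi_lambda _ fun i => by
      by_cases h : i = u
      · simp only [h, dite_true]; exact measurable_const
      · simp only [h, dite_false]; exact measurable_pi_apply _
  have e : (fun ω => Function.update (fun i => X i ω) u 0) =
      (fun (b : ({u}ᶜ : Finset (Fin n)) → ℝ) (i : Fin n) =>
        if h : i = u then (0 : ℝ) else b ⟨i, by simpa using h⟩) ∘
        fun ω (i : ({u}ᶜ : Finset (Fin n))) => X i ω := by
    ext ω i
    by_cases h : i = u
    · subst h; simp
    · simp [h]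
  rw [e]
  exact h.comp hφ hψ

/-- A coordinate is independent of its row sum, the rest of the quadratic form, and any linear form
in the remaining coordinates. -/
lemma Standardized.indepFun_rest (hA : A.IsSymm) (hA0 : ∀ u, A u u = 0) (h : Standardized P δ X)
    (c : Fin n → ℝ) (u : Fin n) :
    IndepFun (X u) (fun ω => (∑ v, A u v * X v ω, form A X ω - X u ω * ∑ v, A u v * X v ω,
      ∑ v, c v * Function.update (fun i => X i ω) u 0 v)) P := by
  have := (indepFun_update h.meas h.indep u).comp (φ := id)
    (ψ := fun z => (∑ v, A u v * z v, 1 / 2 * ∑ i, z i * ∑ j, A i j * z j, ∑ v, c v * z v))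
    measurable_id (by fun_prop)
  have e : (fun ω => (∑ v, A u v * X v ω, form A X ω - X u ω * ∑ v, A u v * X v ω,
      ∑ v, c v * Function.update (fun i => X i ω) u 0 v)) =
      (fun z : Fin n → ℝ => (∑ v, A u v * z v, 1 / 2 * ∑ i, z i * ∑ j, A i j * z j,
        ∑ v, c v * z v)) ∘ fun ω => Function.update (fun i => X i ω) u 0 := by
    ext1 ω
    simp only [Function.comp, sum_mul_update_zero hA0, half_sum_update_zero hA hA0,
      form_eq_half hA hA0]
  rw [e]
  exact this

lemma two_le_ofReal (hδ0 : 0 < δ) : (2 : ℝ≥0∞) ≤ ENNReal.ofReal (2 + δ) := by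
  rw [← ENNReal.ofReal_ofNat]; exact ENNReal.ofReal_le_ofReal (by linarith)

lemma Standardized.memLp_sum (h : Standardized P δ X) (c : Fin n → ℝ) (s : Finset (Fin n)) :
    MemLp (fun ω => ∑ i ∈ s, c i * X i ω) (ENNReal.ofReal (2 + δ)) P :=
  memLp_finsetSum _ fun j _ => (h.memLp j).const_mul (c j)

variable [IsProbabilityMeasure P]

lemma Standardized.memLp_two_sum (hδ0 : 0 < δ) (h : Standardized P δ X) (c : Fin n → ℝ)
    (s : Finset (Fin n)) : MemLp (fun ω => ∑ i ∈ s, c i * X i ω) 2 P :=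
  (h.memLp_sum c s).mono_exponent (two_le_ofReal hδ0)

lemma Standardized.integral_sum (hδ0 : 0 < δ) (h : Standardized P δ X) (c : Fin n → ℝ)
    (s : Finset (Fin n)) : ∫ ω, ∑ i ∈ s, c i * X i ω ∂P = 0 := by
  rw [integral_finsetSum _ fun i _ => (((h.memLp i).mono_exponent
    (two_le_ofReal hδ0)).integrable (by norm_num)).const_mul (c i)]
  simp [integral_const_mul, h.mean]

lemma Standardized.integral_sum_sq (hδ0 : 0 < δ) (h : Standardized P δ X) (c : Fin n → ℝ)
    (s : Finset (Fin n)) : ∫ ω, (∑ i ∈ s, c i * X i ω) ^ 2 ∂P = ∑ i ∈ s, c i ^ 2 := by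
  induction s using Finset.induction_on with
  | empty => simp
  | insert i s hi ih =>
    have i1 := h.memLp_two_sum hδ0 c s
    have i2 : MemLp (fun ω => c i * X i ω) 2 P :=
      ((h.memLp i).mono_exponent (two_le_ofReal hδ0)).const_mul (c i)
    have hind := indepFun_sum_smul h.meas h.indep c hi
    have i3 : Integrable (fun ω => (∑ j ∈ s, c j * X j ω) * (c i * X i ω)) P :=
      hind.integrable_mul (i1.integrable (by norm_num)) (i2.integrable (by norm_num))
    have e3 : ∫ ω, (∑ j ∈ s, c j * X j ω) * (c i * X i ω) ∂P = 0 := by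
      have := hind.integral_mul_eq_mul_integral i1.1 i2.1
      rw [h.integral_sum hδ0, zero_mul] at this
      exact this
    have e2 : ∫ ω, (c i * X i ω) ^ 2 ∂P = c i ^ 2 := by
      simp only [mul_pow]
      rw [integral_const_mul, h.mean_sq, mul_one]
    have hexp : ∀ ω, (∑ j ∈ insert i s, c j * X j ω) ^ 2 = (∑ j ∈ s, c j * X j ω) ^ 2 +
        2 * ((∑ j ∈ s, c j * X j ω) * (c i * X i ω)) + (c i * X i ω) ^ 2 := fun ω => by
      rw [Finset.sum_insert hi]; ring
    simp only [hexp]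
    rw [integral_add (i1.integrable_sq.fun_add (i3.const_mul 2)) i2.integrable_sq,
      integral_add i1.integrable_sq (i3.const_mul 2), integral_const_mul, e3, e2, ih,
      Finset.sum_insert hi]
    ring

lemma Standardized.integral_abs_sum_rpow_le (hδ0 : 0 < δ) (hδ1 : δ ≤ 1) (h : Standardized P δ X)
    (hM : ∀ i, ∫ ω, |X i ω| ^ (2 + δ) ∂P ≤ M) (c : Fin n → ℝ) :
    ∫ ω, |∑ i, c i * X i ω| ^ (2 + δ) ∂P ≤ 6 * (2 + M) * (∑ i, c i ^ 2) ^ ((2 + δ) / 2) := by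
  have h0 : 0 ≤ ∑ i, c i ^ 2 := Finset.sum_nonneg fun _ _ => sq_nonneg _
  rcases h0.eq_or_lt with hr | hr
  · have hc : ∀ i, c i = 0 := fun i => by
      have := (Finset.sum_eq_zero_iff_of_nonneg fun i _ => sq_nonneg (c i)).1 hr.symm i
        (Finset.mem_univ i)
      simpa using this
    simp [hc, Real.zero_rpow (by linarith : 2 + δ ≠ 0),
      Real.zero_rpow (by linarith : (2 + δ) / 2 ≠ 0)]
  · have := integral_abs_sum_rpow_le_of_le_three hδ0 hδ1 h.meas h.indep h.memLp h.mean h.mean_sq hM c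
      hr Finset.univ le_rfl fun t ht => by
        rw [h.integral_sum_sq hδ0]
        exact Finset.sum_le_sum_of_subset_of_nonneg ht fun _ _ _ => sq_nonneg _
    refine this.trans_eq ?_
    rw [show (2 + δ) / 2 = δ / 2 + 1 by ring, Real.rpow_add_one hr.ne']
    ring

lemma Standardized.integral_abs_sum_rpow_le' (hδ0 : 0 < δ) (hδ1 : δ ≤ 1)
    (h : Standardized P δ X) (c : Fin n → ℝ) :
    ∫ ω, |∑ i, c i * X i ω| ^ δ ∂P ≤ 2 * (∑ i, c i ^ 2) ^ (δ / 2) := by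
  have h0 : 0 ≤ ∑ i, c i ^ 2 := Finset.sum_nonneg fun _ _ => sq_nonneg _
  rcases h0.eq_or_lt with hr | hr
  · have hc : ∀ i, c i = 0 := fun i => by
      have := (Finset.sum_eq_zero_iff_of_nonneg fun i _ => sq_nonneg (c i)).1 hr.symm i
        (Finset.mem_univ i)
      simpa using this
    simp [hc, Real.zero_rpow hδ0.ne', Real.zero_rpow (by linarith : δ / 2 ≠ 0)]
  · exact integral_abs_rpow_le hδ0.le (by linarith) (h.memLp_two_sum hδ0 c _)
      (h.integral_sum_sq hδ0 c _).le hr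

/-- Bernoulli's inequality for `(x²)^((2+δ)/2)` at `x² = 1`, integrated against unit variance. It
allows `M` to be absorbed into `M²`. -/
lemma Standardized.one_le_moment (hδ0 : 0 < δ) (h : Standardized P δ X) (i : Fin n) :
    1 ≤ ∫ ω, |X i ω| ^ (2 + δ) ∂P := by
  have i2 := ((h.memLp i).mono_exponent (two_le_ofReal hδ0)).integrable_sq
  have hpt : ∀ x : ℝ, 1 + (2 + δ) / 2 * (x ^ 2 - 1) ≤ |x| ^ (2 + δ) := by
    intro x
    have h1 := one_add_mul_self_le_rpow_one_add (s := x ^ 2 - 1) (by nlinarith [sq_nonneg x])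
      (p := (2 + δ) / 2) (by linarith)
    rwa [add_sub_cancel, ← sq_abs x, ← Real.rpow_natCast, ← Real.rpow_mul (abs_nonneg x),
      show ((2 : ℕ) : ℝ) * ((2 + δ) / 2) = 2 + δ by push_cast; ring, Real.rpow_natCast, sq_abs] at h1
  have i3 : Integrable (fun ω => (2 + δ) / 2 * (X i ω ^ 2 - 1)) P :=
    (i2.sub (integrable_const 1)).const_mul _
  have := integral_mono ((integrable_const 1).fun_add i3)
    (integrable_abs_rpow (by linarith) le_rfl (h.memLp i)) fun ω => hpt (X i ω)
  rw [integral_add (integrable_const 1) i3, integral_const_mul,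
    integral_sub i2 (integrable_const 1), h.mean_sq] at this
  simpa using this

/-- Square integrability comes from independence of `X_u` and its row sum; fourth moments are not
available for Hölder's inequality. -/
lemma Standardized.memLp_two_mul (hδ0 : 0 < δ) (hA0 : ∀ u, A u u = 0) (h : Standardized P δ X)
    (u : Fin n) : MemLp (fun ω => X u ω * ∑ v, A u v * X v ω) 2 P := by
  have hu := (h.memLp u).mono_exponent (two_le_ofReal hδ0)
  have hS := h.memLp_two_sum hδ0 (A u) Finset.univ
  have hS' : MemLp (fun ω => ∑ v, A u v * Function.update (fun i => X i ω) u 0 v) 2 P := by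
    simpa only [sum_mul_update_zero hA0] using hS
  have := (IndepFun.integrable_mul_and_integral (indepFun_update h.meas h.indep u)
    (φ := fun x => x ^ 2) (ψ := fun z => (∑ v, A u v * z v) ^ 2) (by fun_prop) (by fun_prop)
    hu.integrable_sq hS'.integrable_sq).1
  simp only [sum_mul_update_zero hA0] at this
  refine (memLp_two_iff_integrable_sq (hu.1.mul hS.1)).2 (this.congr (Eventually.of_forall fun ω => ?_))
  simp only [Pi.mul_apply]; ring

lemma Standardized.memLp_form (hδ0 : 0 < δ) (hA : A.IsSymm) (hA0 : ∀ u, A u u = 0)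
    (h : Standardized P δ X) : MemLp (form A X) 2 P := by
  have : form A X = fun ω => 1 / 2 * ∑ u, X u ω * ∑ v, A u v * X v ω :=
    funext fun ω => form_eq_half hA hA0 ω
  rw [this]
  exact (memLp_finsetSum _ fun u _ => h.memLp_two_mul hδ0 hA0 u).const_mul _

lemma measurable_form (hX : ∀ k, Measurable (X k)) : Measurable (form A X) := by
  unfold form; fun_prop

lemma Standardized.integral_form (hδ0 : 0 < δ) (hA : A.IsSymm) (hA0 : ∀ u, A u u = 0)
    (h : Standardized P δ X) : ∫ ω, form A X ω ∂P = 0 := by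
  simp only [form_eq_half hA hA0]
  rw [integral_const_mul, integral_finsetSum _ fun u _ =>
    (h.memLp_two_mul hδ0 hA0 u).integrable (by norm_num)]
  rw [Finset.sum_eq_zero, mul_zero]
  intro u _
  have := (IndepFun.integrable_mul_and_integral (h.indepFun_rest hA hA0 0 u) (φ := id)
    (ψ := fun v => v.1) measurable_id (by fun_prop)
    (((h.memLp u).mono_exponent (two_le_ofReal hδ0)).integrable (by norm_num))
    ((h.memLp_two_sum hδ0 (A u) Finset.univ).integrable (by norm_num))).2
  simpa [h.mean u] using this

lemma Standardized.variance_form (hδ0 : 0 < δ) (hA : A.IsSymm) (hA0 : ∀ u, A u u = 0)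
    (h : Standardized P δ X) : Var[form A X; P] = 1 / 2 * ∑ u, ∑ v, A u v ^ 2 := by
  have hF := h.memLp_form hδ0 hA hA0
  rw [variance_of_integral_eq_zero hF.1.aemeasurable (h.integral_form hδ0 hA hA0)]
  -- Only one factor of `F²` is expanded. In the other, `F = w_u + X_u S_u`; the part `X_u S_u w_u`
  -- has mean zero and `X_u² S_u²` has mean `∑_v a_{uv}²`.
  have hexp : ∀ ω, form A X ω ^ 2 =
      1 / 2 * ∑ u, X u ω * (∑ v, A u v * X v ω) * form A X ω := fun ω => by
    rw [sq]
    nth_rw 1 [form_eq_half hA hA0]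
    rw [← Finset.sum_mul]; ring
  have hi : ∀ u, Integrable (fun ω => X u ω * (∑ v, A u v * X v ω) * form A X ω) P := fun u =>
    (h.memLp_two_mul hδ0 hA0 u).integrable_mul hF
  simp only [hexp]
  rw [integral_const_mul, integral_finsetSum _ fun u _ => hi u]
  congr 1
  refine Finset.sum_congr rfl fun u _ => ?_
  have hu := (h.memLp u).mono_exponent (two_le_ofReal hδ0)
  have hS := h.memLp_two_sum hδ0 (A u) Finset.univ
  have hind := h.indepFun_rest hA hA0 0 u
  have hw : MemLp (fun ω => form A X ω - X u ω * ∑ v, A u v * X v ω) 2 P :=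
    hF.sub (h.memLp_two_mul hδ0 hA0 u)
  obtain ⟨i1, e1⟩ := IndepFun.integrable_mul_and_integral hind (φ := id)
    (ψ := fun v => v.1 * v.2.1) measurable_id (by fun_prop) (hu.integrable (by norm_num))
    (hS.integrable_mul hw)
  obtain ⟨i2, e2⟩ := IndepFun.integrable_mul_and_integral hind (φ := fun x => x ^ 2)
    (ψ := fun v => v.1 ^ 2) (by fun_prop) (by fun_prop) hu.integrable_sq hS.integrable_sq
  simp only [id, h.mean u, zero_mul] at e1 i1
  simp only [h.mean_sq u, one_mul] at e2 i2
  rw [h.integral_sum_sq hδ0] at e2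
  have : ∀ ω, X u ω * (∑ v, A u v * X v ω) * form A X ω =
      X u ω * ((∑ v, A u v * X v ω) * (form A X ω - X u ω * ∑ v, A u v * X v ω)) +
        X u ω ^ 2 * (∑ v, A u v * X v ω) ^ 2 := fun ω => by ring
  simp only [this]
  rw [integral_add i1 i2, e1, e2, zero_add]

end Standardized

/-! ### The Stein bound at unit variance. -/

section UnitVariance

variable {Ω : Type*} [MeasurableSpace Ω] {P : Measure Ω} [IsProbabilityMeasure P]
  {n : ℕ} {X : Fin n → Ω → ℝ} {A : Matrix (Fin n) (Fin n) ℝ} {δ M : ℝ}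

/-- Moment bound for a row of the Gram matrix with the diagonal entry removed. -/
lemma Standardized.moment_gram_row (hδ0 : 0 < δ) (hδ1 : δ ≤ 1) (h : Standardized P δ X)
    (c : Fin n → ℝ) (u : Fin n) :
    Measurable (fun ω => ∑ w, c w * Function.update (fun i => X i ω) u 0 w) ∧
    MemLp (fun ω => ∑ w, c w * Function.update (fun i => X i ω) u 0 w)
      (ENNReal.ofReal ((2 + δ) / 2)) P ∧
    ∫ ω, |∑ w, c w * Function.update (fun i => X i ω) u 0 w| ^ ((2 + δ) / 2) ∂P ≤
      8 * ∑ w, |c w| ^ ((2 + δ) / 2) := by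
  have hle : ENNReal.ofReal ((2 + δ) / 2) ≤ ENNReal.ofReal (2 + δ) :=
    ENNReal.ofReal_le_ofReal (by linarith)
  -- The zero is moved from the variable to its coefficient, making this an ordinary linear form in
  -- all the variables.
  have e : ∀ ω, ∑ w, c w * Function.update (fun i => X i ω) u 0 w =
      ∑ w, Function.update c u 0 w * X w ω := fun ω => by
    refine Finset.sum_congr rfl fun w _ => ?_
    rcases eq_or_ne w u with rfl | hw
    · simp
    · rw [Function.update_of_ne hw, Function.update_of_ne hw]
  simp only [e]
  have hXq : ∀ i, MemLp (X i) (ENNReal.ofReal ((2 + δ) / 2)) P := fun i =>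
    (h.memLp i).mono_exponent hle
  refine ⟨Finset.measurable_fun_sum _ fun j _ => (h.meas j).const_mul _,
    (h.memLp_sum _ _).mono_exponent hle, ?_⟩
  refine (integral_abs_sum_rpow_le_of_le_two (by linarith) (by linarith) h.meas h.indep hXq h.mean
    (B := 2) (fun i => ?_) _ Finset.univ).trans ?_
  · simpa using integral_abs_rpow_le (by linarith) (by linarith : (2 + δ) / 2 ≤ 2)
      ((h.memLp i).mono_exponent (two_le_ofReal hδ0)) (h.mean_sq i).le one_pos
  · have : ∑ w, |Function.update c u 0 w| ^ ((2 + δ) / 2) ≤ ∑ w, |c w| ^ ((2 + δ) / 2) := by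
      refine Finset.sum_le_sum fun w _ => Real.rpow_le_rpow (abs_nonneg _) ?_ (by linarith)
      rcases eq_or_ne w u with rfl | hw
      · simp
      · rw [Function.update_of_ne hw]
    linarith

lemma mul_add_rpow_mul_balance {δ R T : ℝ} (hδ0 : 0 < δ) (hR : 0 < R) (hT : 0 < T) :
    ∃ l : ℝ, 0 < l ∧ l * R = R ^ (δ / (2 + δ)) * T ^ (2 / (2 + δ)) ∧
      l ^ (-(δ / 2)) * T = R ^ (δ / (2 + δ)) * T ^ (2 / (2 + δ)) := by
  have hp : 2 + δ ≠ 0 := by linarith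
  -- The weight solves `l R = l^(-δ/2) T`, which equalises the two terms of Young's inequality.
  refine ⟨(T / R) ^ (2 / (2 + δ)), by positivity, ?_, ?_⟩
  · have h1 : R ^ (δ / (2 + δ)) = R / R ^ (2 / (2 + δ)) := by
      rw [show δ / (2 + δ) = 1 - 2 / (2 + δ) by field_simp; ring, Real.rpow_sub hR, Real.rpow_one]
    rw [Real.div_rpow hT.le hR.le, h1]; ring
  · have h1 : T ^ (2 / (2 + δ)) = T / T ^ (δ / (2 + δ)) := by
      rw [show 2 / (2 + δ) = 1 - δ / (2 + δ) by field_simp; ring, Real.rpow_sub hT, Real.rpow_one]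
    rw [← Real.rpow_mul (by positivity), Real.div_rpow hT.le hR.le,
      show 2 / (2 + δ) * -(δ / 2) = -(δ / (2 + δ)) by field_simp, Real.rpow_neg hR.le,
      Real.rpow_neg hT.le, div_inv_eq_mul, h1]
    ring

/-- Normal approximation of a quadratic form of unit variance. -/
theorem Standardized.stein_bound (hδ0 : 0 < δ) (hδ1 : δ ≤ 1) (hA : A.IsSymm)
    (hA0 : ∀ u, A u u = 0) (h : Standardized P δ X)
    (hM : ∀ i, ∫ ω, |X i ω| ^ (2 + δ) ∂P ≤ M) (hM1 : 1 ≤ M) (hσ : ∑ u, ∑ v, A u v ^ 2 = 2)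
    {k : ℝ → ℝ} (hk : Differentiable ℝ k) (hk1 : ∀ x, |deriv k x| ≤ 1) :
    |∫ ω, k (form A X ω) ∂P - ∫ x, k x ∂(gaussianReal 0 1)| ≤
      1000 * M ^ 2 * (rowSum δ A ^ (δ / (2 + δ)) * crossSum δ A ^ (2 / (2 + δ)) +
        rowSum δ A) := by
  obtain ⟨f, f', hf, hfs, hf3, hf8, hfc, hfδ⟩ := exists_stein_solution_holder hδ0 hδ1 hk hk1
  have hfcont : Continuous f := continuous_iff_continuousAt.2 fun z => (hf z).continuousAt
  have hfm : Measurable f := hfcont.measurable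
  have hfm' : Measurable f' := hfc.measurable
  have hF := h.memLp_form hδ0 hA hA0
  have hFm : Measurable (form A X) := measurable_form h.meas
  have hF1 : Integrable (form A X) P := hF.integrable (by norm_num)
  set S : Fin n → Ω → ℝ := fun u ω => ∑ v, A u v * X v ω with hS
  set Y : Fin n → Ω → ℝ := fun u ω =>
    ∑ w, (∑ k, A k u * A k w) * Function.update (fun i => X i ω) u 0 w with hY
  set r : Fin n → ℝ := fun u => ∑ v, A u v ^ 2 with hr
  have hr0 : ∀ u, 0 ≤ r u := fun u => Finset.sum_nonneg fun _ _ => sq_nonneg _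
  have hSm : ∀ u, Measurable (S u) := fun u =>
    Finset.measurable_fun_sum _ fun j _ => (h.meas j).const_mul _
  have hSp : ∀ u, MemLp (S u) (ENNReal.ofReal (2 + δ)) P := fun u => h.memLp_sum _ _
  have hYb := fun u => h.moment_gram_row hδ0 hδ1 (fun w => ∑ k, A k u * A k w) u
  have hind := fun u => h.indepFun_rest hA hA0 (fun w => ∑ k, A k u * A k w) u
  have hw : ∀ u ω, form A X ω - X u ω * S u ω + X u ω * S u ω = form A X ω := fun u ω => by ring
  -- first-order expansion in each coordinate
  have hexp : ∀ u, |∫ ω, X u ω * S u ω * f (form A X ω) ∂P -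
      ∫ ω, S u ω ^ 2 * f' (form A X ω) ∂P| ≤ 16 * (M + 2) * ∫ ω, |S u ω| ^ (2 + δ) ∂P := by
    intro u
    have hm : Measurable fun v : ℝ × ℝ × ℝ => (v.1, v.2.1) := by fun_prop
    have hind' : IndepFun (X u) (fun ω => (S u ω, form A X ω - X u ω * S u ω)) P :=
      (hind u).comp measurable_id hm
    have := abs_integral_mul_sub_le (w := fun ω => form A X ω - X u ω * S u ω) hδ0 hδ1 (h.meas u)
      (hSm u) (hFm.sub ((h.meas u).mul (hSm u)))
      hind' (h.memLp u) (hSp u)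
      (h.mean u) (h.mean_sq u) (hM u) hf hf3 hf8 hfc hfδ
    simpa only [hw] using this
  have hcen := fun u => abs_integral_mul_centred_le (w := fun ω => form A X ω - X u ω * S u ω)
    hδ0 hδ1 (h.meas u) (hSm u) (hFm.sub ((h.meas u).mul (hSm u))) (hYb u).1 (hind u) (h.memLp u)
    (hSp u) (hYb u).2.1 (h.mean u) (h.mean_sq u) (hM u) hf8 hfc hfδ (hr0 u)
  simp only [hw] at hcen
  have i1 : ∀ u, Integrable (fun ω => X u ω * S u ω * f (form A X ω)) P := fun u =>
    integrable_mul_of_abs_le ((h.memLp_two_mul hδ0 hA0 u).integrable (by norm_num))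
      (hfm.comp hFm) fun ω => hf3 _
  have i2 : ∀ u, Integrable (fun ω => S u ω ^ 2 * f' (form A X ω)) P := fun u =>
    integrable_mul_of_abs_le ((h.memLp_two_sum hδ0 (A u) Finset.univ).integrable_sq)
      (hfm'.comp hFm) fun ω => hf8 _
  -- Stein's equation combined with `∑ X_u S_u = 2F` and the decomposition of `∑ S_u² - 2`; after
  -- the rewriting both sides agree pointwise.
  have hrep : ∫ ω, k (form A X ω) ∂P - ∫ x, k x ∂(gaussianReal 0 1) =
      -(1 / 2) * (∑ u, (∫ ω, X u ω * S u ω * f (form A X ω) ∂P -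
        ∫ ω, S u ω ^ 2 * f' (form A X ω) ∂P) +
        ∑ u, ∫ ω, (r u * (X u ω ^ 2 - 1) + X u ω * Y u ω) * f' (form A X ω) ∂P) := by
    have hki := integrable_of_lipschitz hk.continuous (lipschitz_of_abs_deriv_le_one hk hk1) hF1
    have e1 : ∫ ω, k (form A X ω) ∂P - ∫ x, k x ∂(gaussianReal 0 1) =
        ∫ ω, (k (form A X ω) - ∫ x, k x ∂(gaussianReal 0 1)) ∂P := by
      rw [integral_sub hki (integrable_const _)]; simp
    rw [e1, ← Finset.sum_add_distrib]
    have e2 : ∀ u, ∫ ω, X u ω * S u ω * f (form A X ω) ∂P -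
        ∫ ω, S u ω ^ 2 * f' (form A X ω) ∂P +
        ∫ ω, (r u * (X u ω ^ 2 - 1) + X u ω * Y u ω) * f' (form A X ω) ∂P =
        ∫ ω, (X u ω * S u ω * f (form A X ω) - S u ω ^ 2 * f' (form A X ω) +
          (r u * (X u ω ^ 2 - 1) + X u ω * Y u ω) * f' (form A X ω)) ∂P := fun u => by
      rw [integral_add (integrable_fun_sub (i1 u) (i2 u)) (hcen u).1, integral_sub (i1 u) (i2 u)]
    simp only [e2]
    rw [← integral_finsetSum _ fun u _ =>
      (integrable_fun_sub (i1 u) (i2 u)).fun_add (hcen u).1, ← integral_const_mul]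
    refine integral_congr_ae (Eventually.of_forall fun ω => ?_)
    simp only [← hfs]
    have e3 := sum_row_sq_sub (A := A) fun i => X i ω
    simp only [sum_row_sq_eq hA] at e3
    rw [show ∑ u, ∑ v, A u v ^ 2 = 2 from hσ] at e3
    have e4 := form_eq_half (X := X) hA hA0 ω
    rw [Finset.sum_add_distrib, Finset.sum_sub_distrib, ← Finset.sum_mul, ← Finset.sum_mul,
      ← Finset.sum_mul]
    change ∑ u, S u ω ^ 2 - 2 = ∑ u, (r u * (X u ω ^ 2 - 1) + X u ω * Y u ω) at e3
    change form A X ω = 1 / 2 * ∑ u, X u ω * S u ω at e4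
    rw [← e3]
    have e5 : ∑ u, X u ω * S u ω = 2 * form A X ω := by linarith
    rw [e5]; ring
  -- Otherwise every row of `A` would vanish, against `∑ a_{uv}² = 2`. Positivity of `R` and `T` is
  -- what makes the optimal weight available.
  have hRpos : 0 < rowSum δ A := by
    refine (rowSum_nonneg δ A).lt_of_ne fun h0 => ?_
    have h1 := (Finset.sum_eq_zero_iff_of_nonneg fun u _ =>
      Real.rpow_nonneg (hr0 u) ((2 + δ) / 2)).1 h0.symm
    have h2 : ∑ u, r u = 0 := Finset.sum_eq_zero fun u hu =>
      ((Real.rpow_eq_zero_iff_of_nonneg (hr0 u)).1 (h1 u hu)).1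
    have h3 : ∑ u, r u = 2 := hσ
    linarith
  have hTpos : 0 < crossSum δ A := hRpos.trans_le (rowSum_le_crossSum hA)
  obtain ⟨l, hl, hlR, hlT⟩ := mul_add_rpow_mul_balance hδ0 hRpos hTpos
  set L := rowSum δ A ^ (δ / (2 + δ)) * crossSum δ A ^ (2 / (2 + δ)) with hL
  have hL0 : 0 ≤ L := by positivity
  have hSmom : ∀ u, ∫ ω, |S u ω| ^ (2 + δ) ∂P ≤ 18 * M * r u ^ ((2 + δ) / 2) := fun u => by
    refine (h.integral_abs_sum_rpow_le hδ0 hδ1 hM (A u)).trans ?_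
    have : 0 ≤ r u ^ ((2 + δ) / 2) := Real.rpow_nonneg (hr0 u) _
    change 6 * (2 + M) * r u ^ ((2 + δ) / 2) ≤ _
    exact mul_le_mul_of_nonneg_right (by linarith) this
  have b1 : ∑ u, |∫ ω, X u ω * S u ω * f (form A X ω) ∂P -
      ∫ ω, S u ω ^ 2 * f' (form A X ω) ∂P| ≤ 864 * M ^ 2 * rowSum δ A := by
    rw [rowSum, Finset.mul_sum]
    refine Finset.sum_le_sum fun u _ => (hexp u).trans ?_
    calc 16 * (M + 2) * ∫ ω, |S u ω| ^ (2 + δ) ∂P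
        ≤ 16 * (3 * M) * (18 * M * r u ^ ((2 + δ) / 2)) :=
          mul_le_mul (by linarith) (hSmom u) (integral_nonneg fun ω => by positivity)
            (by linarith)
      _ = _ := by ring
  have hrr : ∀ u, r u * r u ^ (δ / 2) = r u ^ ((2 + δ) / 2) := fun u => by
    rw [show (2 + δ) / 2 = 1 + δ / 2 by ring, Real.rpow_add_of_nonneg (hr0 u) zero_le_one
      (by linarith), Real.rpow_one]
  have b2 : ∑ u, |∫ ω, (r u * (X u ω ^ 2 - 1) + X u ω * Y u ω) * f' (form A X ω) ∂P| ≤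
      96 * M * rowSum δ A + 32 * (l * (18 * M * rowSum δ A) +
        l ^ (-(δ / 2)) * (8 * crossSum δ A)) := by
    have hY' : ∀ u, ∫ ω, |S u ω| ^ δ * |Y u ω| ∂P ≤ l * (18 * M * r u ^ ((2 + δ) / 2)) +
        l ^ (-(δ / 2)) * (8 * ∑ w, |∑ k, A k u * A k w| ^ ((2 + δ) / 2)) := fun u => by
      have isp := (integrable_abs_rpow (by linarith) le_rfl (hSp u)).const_mul l
      have iyq := (integrable_abs_rpow (by linarith) le_rfl (hYb u).2.1).const_mul (l ^ (-(δ / 2)))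
      have := integral_mono (integrable_rpow_mul hδ0 (hSm u) (hYb u).1 (hSp u) (hYb u).2.1)
        (isp.fun_add iyq) fun ω => rpow_mul_le_young hδ0 hl (abs_nonneg _) (abs_nonneg _)
      refine this.trans ?_
      rw [integral_add isp iyq, integral_const_mul, integral_const_mul]
      have hlp : 0 < l ^ (-(δ / 2)) := Real.rpow_pos_of_pos hl _
      exact add_le_add (mul_le_mul_of_nonneg_left (hSmom u) hl.le)
        (mul_le_mul_of_nonneg_left (hYb u).2.2 hlp.le)
    have hpt : ∀ u, |∫ ω, (r u * (X u ω ^ 2 - 1) + X u ω * Y u ω) * f' (form A X ω) ∂P| ≤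
        96 * M * r u ^ ((2 + δ) / 2) + 32 * (l * (18 * M * r u ^ ((2 + δ) / 2)) +
        l ^ (-(δ / 2)) * (8 * ∑ w, |∑ k, A k u * A k w| ^ ((2 + δ) / 2))) := fun u => by
      refine (hcen u).2.trans ?_
      have h1 : ∫ ω, |S u ω| ^ δ ∂P ≤ 2 * r u ^ (δ / 2) :=
        h.integral_abs_sum_rpow_le' hδ0 hδ1 (A u)
      have h2 : r u * (M + 2) * ∫ ω, |S u ω| ^ δ ∂P ≤ r u * (3 * M) * (2 * r u ^ (δ / 2)) :=
        mul_le_mul (mul_le_mul_of_nonneg_left (by linarith) (hr0 u)) h1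
          (integral_nonneg fun ω => by positivity) (mul_nonneg (hr0 u) (by linarith))
      have h3 : r u * (3 * M) * (2 * r u ^ (δ / 2)) = 6 * M * r u ^ ((2 + δ) / 2) := by
        rw [← hrr]; ring
      have h4 := hY' u
      linarith
    have hlp : 0 < l ^ (-(δ / 2)) := Real.rpow_pos_of_pos hl _
    calc _ ≤ ∑ u, (96 * M * r u ^ ((2 + δ) / 2) + 32 * (l * (18 * M * r u ^ ((2 + δ) / 2)) +
          l ^ (-(δ / 2)) * (8 * ∑ w, |∑ k, A k u * A k w| ^ ((2 + δ) / 2)))) :=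
          Finset.sum_le_sum fun u _ => hpt u
      _ = 96 * M * rowSum δ A + 32 * (l * (18 * M * rowSum δ A) +
          l ^ (-(δ / 2)) * (8 * ∑ u, ∑ w, |∑ k, A k u * A k w| ^ ((2 + δ) / 2))) := by
          rw [rowSum]
          simp only [Finset.sum_add_distrib, ← Finset.mul_sum]
          rfl
      _ ≤ _ := by
          have := sum_abs_gram_le_crossSum δ A
          gcongr
  rw [hrep, abs_mul]
  have b3 : |∑ u, (∫ ω, X u ω * S u ω * f (form A X ω) ∂P -
        ∫ ω, S u ω ^ 2 * f' (form A X ω) ∂P) +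
        ∑ u, ∫ ω, (r u * (X u ω ^ 2 - 1) + X u ω * Y u ω) * f' (form A X ω) ∂P| ≤
      864 * M ^ 2 * rowSum δ A + (96 * M * rowSum δ A + 32 * (l * (18 * M * rowSum δ A) +
        l ^ (-(δ / 2)) * (8 * crossSum δ A))) :=
    (abs_add_le _ _).trans (add_le_add ((Finset.abs_sum_le_sum_abs _ _).trans b1)
      ((Finset.abs_sum_le_sum_abs _ _).trans b2))
  -- For the chosen weight, `l R` and `l^(-δ/2) T` are both equal to `L`.
  have b4 : l * (18 * M * rowSum δ A) + l ^ (-(δ / 2)) * (8 * crossSum δ A) =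
      (18 * M + 8) * L := by
    linear_combination 18 * M * hlR + 8 * hlT
  rw [b4] at b3
  have hMM : M ≤ M ^ 2 := by nlinarith
  have h5 : M * rowSum δ A ≤ M ^ 2 * rowSum δ A := by gcongr
  have h6 : (18 * M + 8) * L ≤ 26 * M ^ 2 * L := by gcongr; nlinarith
  have h7 : 0 ≤ M ^ 2 * rowSum δ A := by positivity
  have h8 : 0 ≤ M ^ 2 * L := by positivity
  rw [show |(-(1 / 2) : ℝ)| = 1 / 2 by norm_num [abs_of_neg]]
  nlinarith

end UnitVariance

/-! ### Homogeneity in the matrix. -/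

section Scaling

variable {n : ℕ} {A : Matrix (Fin n) (Fin n) ℝ} {δ : ℝ}

lemma rowSum_smul {c : ℝ} (hc : 0 ≤ c) : rowSum δ (c • A) = c ^ (2 + δ) * rowSum δ A := by
  rw [rowSum, rowSum, Finset.mul_sum]
  refine Finset.sum_congr rfl fun u _ => ?_
  simp only [Matrix.smul_apply, smul_eq_mul, mul_pow]
  rw [← Finset.mul_sum, Real.mul_rpow (sq_nonneg c) (Finset.sum_nonneg fun _ _ => sq_nonneg _),
    ← Real.rpow_natCast, ← Real.rpow_mul hc]
  congr 2; push_cast; ring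

lemma crossSum_smul {c : ℝ} (hc : 0 ≤ c) : crossSum δ (c • A) = c ^ (2 + δ) * crossSum δ A := by
  have h2 : (c ^ 2) ^ ((2 + δ) / 2) = c ^ (2 + δ) := by
    rw [← Real.rpow_natCast, ← Real.rpow_mul hc]
    congr 1; push_cast; ring
  have h1 : ∀ x : ℝ, |c ^ 2 * x| ^ ((2 + δ) / 2) = c ^ (2 + δ) * |x| ^ ((2 + δ) / 2) := fun x => by
    rw [abs_mul, Real.mul_rpow (abs_nonneg _) (abs_nonneg _), abs_of_nonneg (sq_nonneg c), h2]
  have h3 : ∀ u v k, (c • A) k u * (c • A) k v = c ^ 2 * (A k u * A k v) := fun u v k => by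
    simp only [Matrix.smul_apply, smul_eq_mul]; ring
  simp only [crossSum, h3, ← Finset.mul_sum, h1]
  ring

lemma form_smul {Ω : Type*} {X : Fin n → Ω → ℝ} (c : ℝ) (ω : Ω) :
    form (c • A) X ω = c * form A X ω := by
  simp only [form, Finset.mul_sum, Matrix.smul_apply, smul_eq_mul, mul_assoc]

end Scaling

/-! ### General variance, characteristic functions and the limit theorem. -/

section General

variable {Ω : Type*} [MeasurableSpace Ω] {P : Measure Ω}
  {n : ℕ} {X : Fin n → Ω → ℝ} {A : Matrix (Fin n) (Fin n) ℝ} {δ M : ℝ}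

lemma Standardized.of_variance (hX : ∀ k, Measurable (X k)) (hind : iIndepFun X P)
    (hXp : ∀ k, MemLp (X k) (ENNReal.ofReal (2 + δ)) P) (hX0 : ∀ k, ∫ ω, X k ω ∂P = 0)
    (hX2 : ∀ k, Var[X k; P] = 1) : Standardized P δ X :=
  ⟨hX, hind, hXp, hX0, fun k => by
    rw [← hX2 k, variance_of_integral_eq_zero (hX k).aemeasurable (hX0 k)]⟩

variable [IsProbabilityMeasure P]

lemma Standardized.sigma_sq (hδ0 : 0 < δ) (hA : A.IsSymm) (hA0 : ∀ u, A u u = 0)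
    (h : Standardized P δ X) : sigma P A X ^ 2 = 1 / 2 * ∑ u, ∑ v, A u v ^ 2 := by
  rw [sigma, Real.sq_sqrt (variance_nonneg _ _), h.variance_form hδ0 hA hA0]

/-- Normal approximation of a quadratic form. -/
theorem Standardized.abs_integral_sub_le (hδ0 : 0 < δ) (hδ1 : δ ≤ 1) (hA : A.IsSymm)
    (hA0 : ∀ u, A u u = 0) (h : Standardized P δ X)
    (hM : ∀ i, ∫ ω, |X i ω| ^ (2 + δ) ∂P ≤ M) (hM1 : 1 ≤ M) (hσ : 0 < sigma P A X)
    {k : ℝ → ℝ} (hk : Differentiable ℝ k) (hk1 : ∀ x, |deriv k x| ≤ 1) :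
    |∫ ω, k (form A X ω / sigma P A X) ∂P - ∫ x, k x ∂(gaussianReal 0 1)| ≤
      1000 / sigma P A X ^ (2 + δ) * M ^ 2 *
        (rowSum δ A ^ (δ / (2 + δ)) * crossSum δ A ^ (2 / (2 + δ)) + rowSum δ A) := by
  set σ := sigma P A X with hσdef
  have hc : 0 ≤ σ⁻¹ := (inv_pos.2 hσ).le
  have hsq := h.sigma_sq hδ0 hA hA0
  rw [← hσdef] at hsq
  -- The normalisation is 2 because `σ² = ½ ∑ a_{uv}²`.
  have hnorm : ∑ u, ∑ v, (σ⁻¹ • A) u v ^ 2 = 2 := by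
    simp only [Matrix.smul_apply, smul_eq_mul, mul_pow, ← Finset.mul_sum]
    rw [show ∑ u, ∑ v, A u v ^ 2 = 2 * σ ^ 2 by linarith]
    field_simp
  have := h.stein_bound hδ0 hδ1 (A := σ⁻¹ • A) (hA.smul _) (fun u => by simp [hA0 u]) hM hM1 hnorm
    hk hk1
  simp only [form_smul, rowSum_smul hc, crossSum_smul hc, inv_mul_eq_div] at this
  refine this.trans_eq ?_
  have hR := rowSum_nonneg δ A
  have hT := hR.trans (rowSum_le_crossSum hA)
  have hp : 0 < σ ^ (2 + δ) := Real.rpow_pos_of_pos hσ _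
  rw [Real.inv_rpow hσ.le, Real.mul_rpow (by positivity) hR, Real.mul_rpow (by positivity) hT]
  -- The exponents add up to one, so the mixed term scales like `R` and `T` themselves.
  have h1 : (σ ^ (2 + δ))⁻¹ ^ (δ / (2 + δ)) * (σ ^ (2 + δ))⁻¹ ^ (2 / (2 + δ)) =
      (σ ^ (2 + δ))⁻¹ := by
    rw [← Real.rpow_add (inv_pos.2 hp), show δ / (2 + δ) + 2 / (2 + δ) = 1 by field_simp; ring,
      Real.rpow_one]
  linear_combination 1000 * M ^ 2 * (rowSum δ A ^ (δ / (2 + δ)) * crossSum δ A ^ (2 / (2 + δ))) * h1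

theorem Standardized.d1_le (hδ0 : 0 < δ) (hδ1 : δ ≤ 1) (hA : A.IsSymm)
    (hA0 : ∀ u, A u u = 0) (h : Standardized P δ X) (hσ : 0 < sigma P A X) :
    d1 P (fun ω => form A X ω / sigma P A X) ≤ ENNReal.ofReal
      (1000 / sigma P A X ^ (2 + δ) * maxMoment P (2 + δ) X ^ 2 *
        (rowSum δ A ^ (δ / (2 + δ)) * crossSum δ A ^ (2 / (2 + δ)) + rowSum δ A)) := by
  have hM : ∀ i, ∫ ω, |X i ω| ^ (2 + δ) ∂P ≤ maxMoment P (2 + δ) X :=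
    fun i => le_ciSup (f := fun i => ∫ ω, |X i ω| ^ (2 + δ) ∂P) (Set.finite_range _).bddAbove i
  have hM1 : 1 ≤ maxMoment P (2 + δ) X := by
    -- For `n = 0` the supremum defaults to `0`; that case is excluded because then `σ = 0`.
    rcases isEmpty_or_nonempty (Fin n) with hn | ⟨⟨i⟩⟩
    · have := h.sigma_sq hδ0 hA hA0
      simp only [Finset.univ_eq_empty, Finset.sum_empty, mul_zero] at this
      exact absurd this (by positivity)
    · exact (h.one_le_moment hδ0 i).trans (hM i)
  exact iSup₂_le fun k hk => ENNReal.ofReal_le_ofReal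
    (h.abs_integral_sub_le hδ0 hδ1 hA hA0 hM hM1 hσ hk.1 hk.2)

/-- The characteristic function of a measure close to the Gaussian on Lipschitz test functions is
close to that of the Gaussian. -/
lemma norm_charFun_sub_le {μ : Measure ℝ} [IsProbabilityMeasure μ] {B : ℝ}
    (hB : ∀ k : ℝ → ℝ, Differentiable ℝ k → (∀ x, |deriv k x| ≤ 1) →
      |∫ x, k x ∂μ - ∫ x, k x ∂(gaussianReal 0 1)| ≤ B) (t : ℝ) :
    ‖charFun μ t - charFun (gaussianReal 0 1) t‖ ≤ 2 * (|t| + 1) * B := by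
  have ht : 0 < |t| + 1 := by positivity
  have hexp : ∀ ν : Measure ℝ, IsProbabilityMeasure ν → charFun ν t =
      ((∫ x, Real.cos (t * x) ∂ν : ℝ) : ℂ) + ((∫ x, Real.sin (t * x) ∂ν : ℝ) : ℂ) * Complex.I := by
    intro ν _
    have hc : Integrable (fun x => Real.cos (t * x)) ν :=
      Integrable.of_bound (by fun_prop) 1 (Eventually.of_forall fun x => Real.abs_cos_le_one _)
    have hs : Integrable (fun x => Real.sin (t * x)) ν :=
      Integrable.of_bound (by fun_prop) 1 (Eventually.of_forall fun x => Real.abs_sin_le_one _)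
    rw [charFun_apply_real, ← integral_complex_ofReal, ← integral_complex_ofReal,
      ← integral_mul_const, ← integral_add hc.ofReal (hs.ofReal.mul_const _)]
    refine integral_congr_ae (Eventually.of_forall fun x => ?_)
    simp only
    rw [← Complex.ofReal_mul, Complex.exp_mul_I]
    simp
  have key : ∀ g g' : ℝ → ℝ, (∀ x, HasDerivAt g (g' x) x) → (∀ x, |g' x| ≤ 1) →
      |∫ x, g (t * x) ∂μ - ∫ x, g (t * x) ∂(gaussianReal 0 1)| ≤ (|t| + 1) * B := by
    intro g g' hg hg'
    -- Dividing by `|t| + 1` makes `g(t x)` an admissible test function, including at `t = 0`.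
    have hd : ∀ x, HasDerivAt (fun x => (|t| + 1)⁻¹ * g (t * x))
        ((|t| + 1)⁻¹ * (g' (t * x) * t)) x := fun x => by
      have h1 : HasDerivAt (fun x => t * x) t x := by
        simpa using (hasDerivAt_id' x).const_mul t
      exact ((hg (t * x)).comp x h1).const_mul _
    have := hB _ (fun x => (hd x).differentiableAt) fun x => by
      rw [(hd x).deriv, abs_mul, abs_mul, abs_inv, abs_of_pos ht, inv_mul_le_iff₀ ht]
      nlinarith [hg' (t * x), abs_nonneg t]
    rw [integral_const_mul, integral_const_mul, ← mul_sub, abs_mul, abs_inv, abs_of_pos ht,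
      inv_mul_le_iff₀ ht] at this
    exact this
  have h1 := key Real.cos (fun x => -Real.sin x) Real.hasDerivAt_cos
    fun x => by rw [abs_neg]; exact Real.abs_sin_le_one x
  have h2 := key Real.sin Real.cos Real.hasDerivAt_sin Real.abs_cos_le_one
  rw [hexp μ inferInstance, hexp (gaussianReal 0 1) inferInstance]
  calc _ = ‖((∫ x, Real.cos (t * x) ∂μ - ∫ x, Real.cos (t * x) ∂(gaussianReal 0 1) : ℝ) : ℂ) +
        ((∫ x, Real.sin (t * x) ∂μ - ∫ x, Real.sin (t * x) ∂(gaussianReal 0 1) : ℝ) : ℂ) *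
          Complex.I‖ := by push_cast; congr 1; ring
    _ ≤ |∫ x, Real.cos (t * x) ∂μ - ∫ x, Real.cos (t * x) ∂(gaussianReal 0 1)| +
        |∫ x, Real.sin (t * x) ∂μ - ∫ x, Real.sin (t * x) ∂(gaussianReal 0 1)| := by
      refine (norm_add_le _ _).trans_eq ?_
      rw [norm_mul, Complex.norm_I, mul_one, Complex.norm_real, Complex.norm_real]
      rfl
    _ ≤ _ := by linarith

lemma Standardized.Ltilde_pos (hδ0 : 0 < δ) (hA : A.IsSymm) (hA0 : ∀ u, A u u = 0)
    (h : Standardized P δ X) (hσ : 0 < sigma P A X) : 0 < Ltilde P A X := by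
  refine div_pos ?_ (by positivity)
  by_contra hle
  have h1 : ∀ u, ∑ v, A u v ^ 2 ≤ 0 := fun u =>
    (le_ciSup (f := fun u => ∑ v, A u v ^ 2) (Set.finite_range _).bddAbove u).trans (not_lt.1 hle)
  have h2 := h.sigma_sq hδ0 hA hA0
  have h3 : ∑ u, ∑ v, A u v ^ 2 ≤ 0 := Finset.sum_nonpos fun u _ => h1 u
  nlinarith

lemma Standardized.rowSum_div_le (hδ0 : 0 < δ) (hA : A.IsSymm) (hA0 : ∀ u, A u u = 0)
    (h : Standardized P δ X) (hσ : 0 < sigma P A X) :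
    rowSum δ A / sigma P A X ^ (2 + δ) ≤ 2 * Ltilde P A X ^ (δ / 2) := by
  have hL := h.Ltilde_pos hδ0 hA hA0 hσ
  have hsq := h.sigma_sq hδ0 hA hA0
  set σ := sigma P A X with hσdef
  set L := Ltilde P A X with hLdef
  have hmax : ∀ u, ∑ v, A u v ^ 2 ≤ L * σ ^ 2 := fun u => by
    rw [hLdef, Ltilde, div_mul_cancel₀ _ (by positivity)]
    exact le_ciSup (f := fun u => ∑ v, A u v ^ 2) (Set.finite_range _).bddAbove u
  have hr0 : ∀ u, 0 ≤ ∑ v, A u v ^ 2 := fun u => Finset.sum_nonneg fun _ _ => sq_nonneg _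
  have hσδ : (σ ^ 2) ^ (δ / 2) = σ ^ δ := by
    rw [← Real.rpow_natCast, ← Real.rpow_mul hσ.le]
    congr 1; push_cast; ring
  rw [div_le_iff₀ (Real.rpow_pos_of_pos hσ _)]
  -- One power of each row sum is kept and adds up to `2σ²`; the remaining `δ/2` power is bounded by
  -- the maximal row.
  calc rowSum δ A ≤ ∑ u, (∑ v, A u v ^ 2) * (L * σ ^ 2) ^ (δ / 2) := by
        refine Finset.sum_le_sum fun u _ => ?_
        rw [show (2 + δ) / 2 = 1 + δ / 2 by ring, Real.rpow_add_of_nonneg (hr0 u) zero_le_one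
          (by linarith), Real.rpow_one]
        exact mul_le_mul_of_nonneg_left (Real.rpow_le_rpow (hr0 u) (hmax u) (by linarith)) (hr0 u)
    _ = 2 * σ ^ 2 * (L ^ (δ / 2) * σ ^ δ) := by
        rw [← Finset.sum_mul, Real.mul_rpow hL.le (by positivity), hσδ]
        congr 1; linarith
    _ = 2 * L ^ (δ / 2) * σ ^ (2 + δ) := by
        rw [Real.rpow_add hσ, Real.rpow_two]; ring

/-- The Wasserstein bound in terms of `L̃` only, under a growth condition on the cross sum. -/
lemma Standardized.abs_integral_sub_le_Ltilde {ε K : ℝ} (hδ0 : 0 < δ) (hδ1 : δ ≤ 1)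
    (hA : A.IsSymm) (hA0 : ∀ u, A u u = 0) (h : Standardized P δ X)
    (hM : ∀ i, ∫ ω, |X i ω| ^ (2 + δ) ∂P ≤ M) (hM1 : 1 ≤ M) (hσ : 0 < sigma P A X)
    (hK : Ltilde P A X ^ (δ * (δ - ε) / 4) / sigma P A X ^ (2 + δ) * crossSum δ A ≤ K)
    {k : ℝ → ℝ} (hk : Differentiable ℝ k) (hk1 : ∀ x, |deriv k x| ≤ 1) :
    |∫ ω, k (form A X ω / sigma P A X) ∂P - ∫ x, k x ∂(gaussianReal 0 1)| ≤
      1000 * M ^ 2 * (2 ^ (δ / (2 + δ)) * K ^ (2 / (2 + δ)) *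
        Ltilde P A X ^ (δ * ε / (2 * (2 + δ))) + 2 * Ltilde P A X ^ (δ / 2)) := by
  have hL := h.Ltilde_pos hδ0 hA hA0 hσ
  have hRL := h.rowSum_div_le hδ0 hA hA0 hσ
  refine (h.abs_integral_sub_le hδ0 hδ1 hA hA0 hM hM1 hσ hk hk1).trans ?_
  have hR := rowSum_nonneg δ A
  have hT := hR.trans (rowSum_le_crossSum (δ := δ) hA)
  set L := Ltilde P A X
  have hp : 0 < sigma P A X ^ (2 + δ) := Real.rpow_pos_of_pos hσ _
  set s := sigma P A X ^ (2 + δ)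
  set R := rowSum δ A
  set T := crossSum δ A
  set e := δ * (δ - ε) / 4
  have hLe : 0 < L ^ e := Real.rpow_pos_of_pos hL _
  have hTK : T / s ≤ K * L ^ (-e) := by
    rw [Real.rpow_neg hL.le, ← div_eq_mul_inv, le_div_iff₀ hLe]
    calc T / s * L ^ e = L ^ e / s * T := by ring
      _ ≤ K := hK
  have hK0 : 0 ≤ K := le_trans (by positivity) hK
  have hsplit : (R / s) ^ (δ / (2 + δ)) * (T / s) ^ (2 / (2 + δ)) =
      R ^ (δ / (2 + δ)) * T ^ (2 / (2 + δ)) / s := by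
    rw [Real.div_rpow hR hp.le, Real.div_rpow hT hp.le, div_mul_div_comm, ← Real.rpow_add hp,
      show δ / (2 + δ) + 2 / (2 + δ) = 1 by field_simp; ring, Real.rpow_one]
  have hmain : (R / s) ^ (δ / (2 + δ)) * (T / s) ^ (2 / (2 + δ)) ≤
      2 ^ (δ / (2 + δ)) * K ^ (2 / (2 + δ)) * L ^ (δ * ε / (2 * (2 + δ))) := by
    calc _ ≤ (2 * L ^ (δ / 2)) ^ (δ / (2 + δ)) * (K * L ^ (-e)) ^ (2 / (2 + δ)) := by gcongr
      _ = 2 ^ (δ / (2 + δ)) * K ^ (2 / (2 + δ)) *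
          (L ^ (δ / 2 * (δ / (2 + δ))) * L ^ (-e * (2 / (2 + δ)))) := by
          rw [Real.mul_rpow zero_le_two (by positivity), Real.mul_rpow hK0 (by positivity),
            ← Real.rpow_mul hL.le, ← Real.rpow_mul hL.le]
          ring
      -- The exponents of `L̃` combine as `δ²/(2(2+δ)) - δ(δ-ε)/(2(2+δ)) = δε/(2(2+δ))`, which is
      -- positive exactly because `ε` is.
      _ = _ := by
          rw [← Real.rpow_add hL]
          congr 2
          simp only [e]
          field_simp
          ring
  calc 1000 / s * M ^ 2 * (R ^ (δ / (2 + δ)) * T ^ (2 / (2 + δ)) + R)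
      = 1000 * M ^ 2 * (R ^ (δ / (2 + δ)) * T ^ (2 / (2 + δ)) / s + R / s) := by ring
    _ ≤ _ := by
      rw [← hsplit]
      gcongr

/-- Central limit theorem for quadratic forms in independent standardized variables. -/
theorem tendstoInDistribution_form (hδ0 : 0 < δ) (hδ1 : δ ≤ 1) {X : ℕ → Ω → ℝ}
    {A : (n : ℕ) → Matrix (Fin n) (Fin n) ℝ} {ε K : ℝ}
    (h : ∀ n, Standardized P δ (fun u : Fin n => X u)) (hM1 : 1 ≤ M)
    (hM : ∀ k, ∫ ω, |X k ω| ^ (2 + δ) ∂P ≤ M)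
    (hA : ∀ n, (A n).IsSymm) (hA0 : ∀ n u, A n u u = 0)
    (hσ : ∀ᶠ n in atTop, 0 < sigma P (A n) (fun u => X u))
    (hL : Tendsto (fun n => Ltilde P (A n) (fun u => X u)) atTop (𝓝 0)) (hε : 0 < ε)
    (hK : ∀ n, 0 < sigma P (A n) (fun u => X u) →
      Ltilde P (A n) (fun u => X u) ^ (δ * (δ - ε) / 4) /
        sigma P (A n) (fun u => X u) ^ (2 + δ) * crossSum δ (A n) ≤ K) :
    TendstoInDistribution
      (fun n ω => form (A n) (fun u => X u) ω / sigma P (A n) (fun u => X u))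
      atTop (id : ℝ → ℝ) (fun _ => P) (gaussianReal 0 1) := by
  have hmeas : ∀ n, Measurable fun ω =>
      form (A n) (fun u => X u) ω / sigma P (A n) (fun u => X u) := fun n =>
    (measurable_form (h n).meas).div_const _
  refine ⟨fun n => (hmeas n).aemeasurable, aemeasurable_id, ?_⟩
  refine ProbabilityMeasure.tendsto_iff_tendsto_charFun.2 fun t => ?_
  set B : ℕ → ℝ := fun n => 1000 * M ^ 2 * (2 ^ (δ / (2 + δ)) * K ^ (2 / (2 + δ)) *
    Ltilde P (A n) (fun u => X u) ^ (δ * ε / (2 * (2 + δ))) +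
      2 * Ltilde P (A n) (fun u => X u) ^ (δ / 2)) with hBdef
  have hB0 : Tendsto (fun n => 2 * (|t| + 1) * B n) atTop (𝓝 0) := by
    have h1 : ∀ {a : ℝ}, 0 < a →
        Tendsto (fun n => Ltilde P (A n) (fun u => X u) ^ a) atTop (𝓝 0) := fun {a} ha => by
      have := hL.rpow_const (p := a) (Or.inr ha.le)
      rwa [Real.zero_rpow ha.ne'] at this
    have := ((((h1 (show 0 < δ * ε / (2 * (2 + δ)) by positivity)).const_mul
      (2 ^ (δ / (2 + δ)) * K ^ (2 / (2 + δ)))).add ((h1 (half_pos hδ0)).const_mul 2)).const_mul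
      (1000 * M ^ 2)).const_mul (2 * (|t| + 1))
    simpa using this
  rw [tendsto_iff_norm_sub_tendsto_zero]
  refine squeeze_zero' (Eventually.of_forall fun n => norm_nonneg _) ?_ hB0
  filter_upwards [hσ] with n hn
  have : IsProbabilityMeasure (P.map fun ω =>
      form (A n) (fun u => X u) ω / sigma P (A n) (fun u => X u)) :=
    Measure.isProbabilityMeasure_map (hmeas n).aemeasurable
  simp only [ProbabilityMeasure.coe_mk, Measure.map_id]
  refine norm_charFun_sub_le (fun k hk hk1 => ?_) t
  rw [integral_map (hmeas n).aemeasurable hk.continuous.aestronglyMeasurable]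
  exact (h n).abs_integral_sub_le_Ltilde hδ0 hδ1 (hA n) (hA0 n) (fun i => hM i) hM1 hn (hK n hn)
    hk hk1

end General

end QuadForm

/-! ### The two statements assembled. -/

theorem mainTheorem6 (δ : ℝ) (hδ0 : 0 < δ) (hδ1 : δ ≤ 1) :
    -- the bound on the Wasserstein distance, with a constant depending only on `δ`
    (∃ C : ℝ, 0 < C ∧
      ∀ (Ω : Type*) [MeasurableSpace Ω] (P : Measure Ω) [IsProbabilityMeasure P]
        (n : ℕ) (X : Fin n → Ω → ℝ) (A : Matrix (Fin n) (Fin n) ℝ),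
        (∀ k, Measurable (X k)) → iIndepFun X P →
        (∀ k, MemLp (X k) (ENNReal.ofReal (2 + δ)) P) →
        (∀ k, ∫ ω, X k ω ∂P = 0) → (∀ k, Var[X k; P] = 1) →
        A.IsSymm → (∀ u, A u u = 0) →
        0 < QuadForm.sigma P A X →
        QuadForm.d1 P (fun ω => QuadForm.form A X ω / QuadForm.sigma P A X) ≤
          ENNReal.ofReal
            (C / QuadForm.sigma P A X ^ (2 + δ) * QuadForm.maxMoment P (2 + δ) X ^ 2 *
              (QuadForm.rowSum δ A ^ (δ / (2 + δ)) * QuadForm.crossSum δ A ^ (2 / (2 + δ)) +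
                QuadForm.rowSum δ A))) ∧
    -- the central limit theorem
    (∀ (Ω : Type*) [MeasurableSpace Ω] (P : Measure Ω) [IsProbabilityMeasure P]
        (X : ℕ → Ω → ℝ) (A : (n : ℕ) → Matrix (Fin n) (Fin n) ℝ) (ε : ℝ),
        (∀ k, Measurable (X k)) → iIndepFun X P →
        (∀ k, MemLp (X k) (ENNReal.ofReal (2 + δ)) P) →
        BddAbove (Set.range fun k => ∫ ω, |X k ω| ^ (2 + δ) ∂P) →
        (∀ k, ∫ ω, X k ω ∂P = 0) → (∀ k, Var[X k; P] = 1) →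
        (∀ n, (A n).IsSymm) → (∀ n u, A n u u = 0) →
        (∀ᶠ n in atTop, 0 < QuadForm.sigma P (A n) (fun u => X u)) →
        Tendsto (fun n => QuadForm.Ltilde P (A n) (fun u => X u)) atTop (𝓝 0) →
        0 < ε → ε ≤ δ →
        (∃ K : ℝ, ∀ n, 0 < QuadForm.sigma P (A n) (fun u => X u) →
          QuadForm.Ltilde P (A n) (fun u => X u) ^ (δ * (δ - ε) / 4) /
            QuadForm.sigma P (A n) (fun u => X u) ^ (2 + δ) * QuadForm.crossSum δ (A n) ≤ K) →
        TendstoInDistribution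
          (fun n ω => QuadForm.form (A n) (fun u => X u) ω /
            QuadForm.sigma P (A n) (fun u => X u))
          atTop (id : ℝ → ℝ) (fun _ => P) (gaussianReal 0 1)) := by
  refine ⟨⟨1000, by norm_num, ?_⟩, ?_⟩
  · intro Ω _ P _ n X A hX hind hXp hX0 hX2 hA hA0 hσ
    exact QuadForm.Standardized.d1_le hδ0 hδ1 hA hA0
      (QuadForm.Standardized.of_variance hX hind hXp hX0 hX2) hσ
  · intro Ω _ P _ X A ε hX hind hXp hbdd hX0 hX2 hA hA0 hσ hL hε _ hK
    obtain ⟨K, hK⟩ := hK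
    obtain ⟨M, hM⟩ := hbdd
    have hstd : ∀ n, QuadForm.Standardized P δ (fun u : Fin n => X u) := fun n =>
      QuadForm.Standardized.of_variance (fun k => hX k)
        (hind.precomp Fin.val_injective) (fun k => hXp k) (fun k => hX0 k) (fun k => hX2 k)
    have hM' : ∀ k, ∫ ω, |X k ω| ^ (2 + δ) ∂P ≤ M := fun k => hM (Set.mem_range_self k)
    exact QuadForm.tendstoInDistribution_form hδ0 hδ1 hstd
      -- The case `n = 1` supplies one variable, enough to see that the uniform moment bound is at
      -- least one.
      (((hstd 1).one_le_moment hδ0 0).trans (hM' _)) hM' hA hA0 hσ hL hε hK
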